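/- **Setting.** Let $\Omega=[l,u]\subseteq\mathbb R^n$ with $-l,u\in[0,\infty]^n$ and $l_j<u_j$ for all $j$; $\lambda_1>0$, $\lambda_2\ge 0$, $p\in\{1,2\}$, $w_1,\dots,w_L\ge 0$; $G_1,\dots,G_L\subseteq\{1,\dots,n\}$ (possibly overlapping) with $\bigcup_l G_l=\{1,\dots,n\}$; $x_{(l)}$ is the restriction of $x$ to $G_l$; $\mathcal I(t)=1$ if $t\ne0$, $\mathcal I(0)=0$; $\mathcal A(x)=\{j:x_j=0\}$; $\|\cdot\|$ is the Euclidean norm; $\partial$ is the convex subdifferential and $N_\Omega$ the normal cone. Let $f=f_n+f_s$, where $f_n,f_s:\mathbb R^n\to\mathbb R$ are convex, $f_s$ is differentiable and $\nabla f_s$ is Lipschitz with modulus $L_s>0$; $f$ is Lipschitz on $\Omega$ and level-bounded on $\Omega$ (each set $\{x\in\Omega: f(x)\le a\}$ is bounded). Let $L_f\in\mathbb R$ be an upper bound of $|\xi_j|$ for all $j$ and all $\xi\in\partial f(x)$, $x\in\Omega$, and all $\xi\in\partial f_n(x)+\partial f_s(y)$, $x,y\in\Omega$. Let $0<\nu$,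 $\nu L_f<\lambda_1$, and $\nu<|l_j|$ whenever $l_j\ne0$, $\nu<u_j$ whenever $u_j\ne 0$. For $\mu>0$ put $\theta_1(t;\mu)=0$, $\theta_2(t;\mu)=t/\mu-1$, $\theta_3(t;\mu)=-t/\mu-1$, $\theta_i(t)=\theta_i(t;\nu)$, and $$\bar f_n(x;\mu)=f_n(x)+\tfrac{\lambda_1}{\mu}\|x\|_1+\tfrac{\lambda_2}{\mu}\sum_{l=1}^L w_l\|x_{(l)}\|_p,\qquad \bar f(x;\mu)=\bar f_n(x;\mu)+f_s(x),\qquad \bar f(x)=\bar f(x;\nu),$$ $$F(x;\mu)=\bar f(x;\mu)-\lambda_1\sum_{j=1}^n\max_{i=1,2,3}\theta_i(x_j;\mu)-\lambda_2\sum_{l=1}^L w_l\max_{i=1,2}\theta_i(\|x_{(l)}\|_p;\mu).$$ The two problems are $$(1)\ \ \min_{x\in\Omega}F_0(x):=f(x)+\lambda_1\sum_{j=1}^n\mathcal I(x_j)+\lambda_2\sum_{l=1}^L w_l\,\mathcal I(\|x_{(l)}\|_p),\qquad\qquad (2)\ \ \min_{x\in\Omega}F(x):=F(x;\nu).$$ For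 $x\in\mathbb R^n$ let $I^x_j$ be the largest maximizer of $i\mapsto\theta_i(x_j)$ over $\{1,2,3\}$ and $J^x_l$ the largest maximizer of $i\mapsto\theta_i(\|x_{(l)}\|_p)$ over $\{1,2\}$. A point $x\in\Omega$ is an *sw-d-stationary point* of (2) if $$\lambda_1\sum_{j=1}^n\nabla\theta_{I^x_j}(x_j)+\lambda_2\sum_{l=1}^L w_l\,\partial\theta_{J^x_l}(\|x_{(l)}\|_p)\subseteq\partial\bar f(x)+N_\Omega(x),$$ where $I^x,J^x$ are held fixed and gradients and subdifferentials are taken with respect to $x\in\mathbb R^n$. A *$\nu$-strong local minimizer* of (1) is a local minimizer $x$ of (1) with $|x_j|\ge\nu$ whenever $x_j\ne0$. For $I\in\{1,2,3\}^n$ and $J\in\{1,2\}^L$ put $\Theta_{I,J}(x;\mu)=\lambda_1\sum_j\theta_{I_j}(x_j;\mu)+\lambda_2\sum_l w_l\theta_{J_l}(\|x_{(l)}\|_p;\mu)$ and $$w_{I,J,\xi}(x;\mu,y,z)=\bar f_n(x;\mu)+f_s(y)+\langle\nabla f_s(y),x-y\rangle-\Theta_{I,J}(z;\mu)-\langle\xi,x-z\rangle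 .$$ **Algorithm 1.** Parameters: $x^0\in\Omega$, $\rho>1$, $c\in(0,L_s]$, $0<\underline\alpha\le\bar\alpha$, integers $N,K\ge0$, a decreasing (not necessarily strictly) real sequence $\bar\mu_k$ with $\bar\mu_{K-1}\ge\nu\ge\bar\mu_K$ (only the second inequality if $K=0$); $\mu_k=\bar\mu_k$ for $k<K$ and $\mu_k=\nu$ for $k\ge K$. Write $I^k=I^{x^k}$, $J^k=J^{x^k}$. At iteration $k$ choose $\alpha^B_k\in[\underline\alpha,\bar\alpha]$; for $m=0,1,\dots$ let $\alpha_k=\alpha^B_k\rho^m$, take some $\xi^k\in\partial_x\Theta_{I^k,J^k}(x^k;\mu_k)$, compute $$x^k(\alpha_k)=\operatorname*{argmin}_{x\in\Omega}\Big\{w_{I^k,J^k,\xi^k}(x;\mu_k,x^k,x^k)+\tfrac{\alpha_k}{2}\|x-x^k\|^2\Big\},$$ and at the first $m$ for which $$F(x^k(\alpha_k);\mu_k)\le\max_{\max\{k-N,0\}\le j\le k}F(x^j;\mu_k)-\tfrac c2\|x^k(\alpha_k)-x^k\|^2$$ set $x^{k+1}=x^k(\alpha_k)$ and pass to iteration $k+1$.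 **Theorem.** Let $\{x^k\}_{k\ge0}$ be an infinite sequence of iterates generated by Algorithm 1. Then: (i) $I^k$ and $J^k$ change only finitely many times, that is, $I^{k+1}\ne I^k$ for only finitely many $k$ and $J^{k+1}\neq J^k$ for only finitely many $k$. For any accumulation points $x^*$ and $\hat x$ of $\{x^k\}$ one has $\mathcal A(x^*)=\mathcal A(\hat x)$, and there is $k_0$ such that $x^k_j=0$ for all $k\ge k_0$ and all $j\in\mathcal A(x^*)$. (ii) Every accumulation point of $\{x^k\}$ is an sw-d-stationary point of problem (2) and a $\nu$-strong local minimizer of problem (1). -/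

import Mathlib

namespace SparseGroup

open scoped Pointwise

/-- The space `ℝⁿ` with its Euclidean norm and inner product. -/
abbrev Vec (n : ℕ) : Type := EuclideanSpace ℝ (Fin n)

/-- Convex subdifferential of a finite function `h : ℝⁿ → ℝ` at `x`. -/
def subdiff {n : ℕ} (h : Vec n → ℝ) (x : Vec n) : Set (Vec n) :=
  {g | ∀ y, h x + inner ℝ g (y - x) ≤ h y}

/-- Normal cone of a set `S` at (a point) `x` (of `S`). -/
def normalCone {n : ℕ} (S : Set (Vec n)) (x : Vec n) : Set (Vec n) :=
  {v | ∀ y ∈ S, inner ℝ v (y - x) ≤ 0}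

/-- `x` is a solution of `min {h(y) : y ∈ S}`. -/
def IsArgmin {n : ℕ} (h : Vec n → ℝ) (S : Set (Vec n)) (x : Vec n) : Prop :=
  x ∈ S ∧ IsMinOn h S x

/-- The zero set `𝒜(x) = {j : x_j = 0}`. -/
def zeroSet {n : ℕ} (x : Vec n) : Set (Fin n) := {j | x j = 0}

/-- `ℐ(t) = 1` if `t ≠ 0` and `ℐ(0) = 0`. -/
noncomputable def ind (t : ℝ) : ℝ := if t = 0 then 0 else 1

/-- The affine pieces `θ₁(t;μ) = 0`, `θ₂(t;μ) = t/μ - 1`, `θ₃(t;μ) = -t/μ - 1`;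
the elements `0, 1, 2` of `Fin 3` stand for the indices `1, 2, 3`. -/
noncomputable def theta (μ : ℝ) (i : Fin 3) (t : ℝ) : ℝ := ![0, t / μ - 1, -t / μ - 1] i

/-- The largest element of `Argmax_i φ i` (the set of maximizers is never empty). -/
noncomputable def lastArgmax {m : ℕ} (φ : Fin (m + 1) → ℝ) : Fin (m + 1) :=
  open Classical in (Finset.univ.filter fun i => ∀ i', φ i' ≤ φ i).sup id

/-- The data of the two optimization problems: the loss `f = fn + fs`, the parameters `λ₁`, `λ₂`,
`p`, the weights and (possibly overlapping) groups, the bounds of the box `Ω = [lo, up]`, and the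
relaxation parameter `ν`. The conditions on them are in `Assumptions`. -/
structure Data (n L : ℕ) where
  fn : Vec n → ℝ
  fs : Vec n → ℝ
  lam₁ : ℝ
  lam₂ : ℝ
  p : ENNReal
  w : Fin L → ℝ
  G : Fin L → Finset (Fin n)
  lo : Fin n → EReal
  up : Fin n → EReal
  ν : ℝ

namespace Data

variable {n L : ℕ} (D : Data n L)

/-- The loss function `f`. -/
def f (x : Vec n) : ℝ := D.fn x + D.fs x

/-- The box `Ω = [lo, up]`. -/
def Ω : Set (Vec n) := {x | ∀ j, D.lo j ≤ (x j : EReal) ∧ (x j : EReal) ≤ D.up j}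

/-- `‖x_(l)‖_p`, where `x_(l)` is the restriction of `x` to the `l`-th group. -/
noncomputable def groupNorm (l : Fin L) (x : Vec n) : ℝ :=
  ‖(WithLp.toLp D.p fun j : D.G l => x j : PiLp D.p fun _ : D.G l => ℝ)‖

/-- The objective `F₀` of the sparse group `ℓ₀` problem. -/
noncomputable def F₀ (x : Vec n) : ℝ :=
  D.f x + D.lam₁ * ∑ j, ind (x j) + D.lam₂ * ∑ l, D.w l * ind (D.groupNorm l x)

/-- `(λ₁/μ) ‖x‖₁ + (λ₂/μ) ∑ w_l ‖x_(l)‖_p`. -/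
noncomputable def penalty (μ : ℝ) (x : Vec n) : ℝ :=
  D.lam₁ / μ * ∑ j, |x j| + D.lam₂ / μ * ∑ l, D.w l * D.groupNorm l x

/-- `f̄(x;μ)`. -/
noncomputable def fbar (μ : ℝ) (x : Vec n) : ℝ := D.f x + D.penalty μ x

/-- `f̄_n(x;μ)`. -/
noncomputable def fbarn (μ : ℝ) (x : Vec n) : ℝ := D.fn x + D.penalty μ x

/-- The relaxed objective `F(x;μ)`; the objective of the relaxation problem is `F(x;ν)`. -/
noncomputable def F (μ : ℝ) (x : Vec n) : ℝ :=
  D.fbar μ x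
    - D.lam₁ * ∑ j, max (max (theta μ 0 (x j)) (theta μ 1 (x j))) (theta μ 2 (x j))
    - D.lam₂ * ∑ l, D.w l * max (theta μ 0 (D.groupNorm l x)) (theta μ 1 (D.groupNorm l x))

/-- `Θ_{I,J}(x;μ)`. -/
noncomputable def Theta (I : Fin n → Fin 3) (J : Fin L → Fin 2) (μ : ℝ) (x : Vec n) : ℝ :=
  D.lam₁ * ∑ j, theta μ (I j) (x j)
    + D.lam₂ * ∑ l, D.w l * theta μ (J l).castSucc (D.groupNorm l x)

/-- The index vector `I^x`: the largest maximizing index of `θ_i(x_j) = θ_i(x_j;ν)`, `i = 1,2,3`. -/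
noncomputable def idxI (x : Vec n) : Fin n → Fin 3 :=
  fun j => lastArgmax fun i => theta D.ν i (x j)

/-- The index vector `J^x`: the largest maximizing index of `θ_i(‖x_(l)‖_p)`, `i = 1,2`. -/
noncomputable def idxJ (x : Vec n) : Fin L → Fin 2 :=
  fun l => lastArgmax fun i : Fin 2 => theta D.ν i.castSucc (D.groupNorm l x)

/-- The convex model `w_{I,J,ξ}(x;μ,y,z)`. -/
noncomputable def model (I : Fin n → Fin 3) (J : Fin L → Fin 2) (ξ : Vec n) (μ : ℝ)
    (y z x : Vec n) : ℝ :=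
  D.fbarn μ x + D.fs y + inner ℝ (gradient D.fs y) (x - y) - D.Theta I J μ z - inner ℝ ξ (x - z)

/-- The standing assumptions of the problem, with the constants `Lf` and `Ls`. -/
structure Assumptions (Lf Ls : ℝ) : Prop where
  lam₁_pos : 0 < D.lam₁
  lam₂_nonneg : 0 ≤ D.lam₂
  p_eq : D.p = 1 ∨ D.p = 2
  w_nonneg : ∀ l, 0 ≤ D.w l
  cover : ∀ j, ∃ l, j ∈ D.G l
  lo_nonpos : ∀ j, D.lo j ≤ 0
  up_nonneg : ∀ j, 0 ≤ D.up j
  lo_lt_up : ∀ j, D.lo j < D.up j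
  /- conditions on `f = fn + fs` -/
  convex_fn : ConvexOn ℝ Set.univ D.fn
  convex_fs : ConvexOn ℝ Set.univ D.fs
  diff_fs : Differentiable ℝ D.fs
  Ls_pos : 0 < Ls
  lip_grad : ∀ x y, ‖gradient D.fs x - gradient D.fs y‖ ≤ Ls * ‖x - y‖
  lip_f : ∃ C : NNReal, LipschitzOnWith C D.f D.Ω
  level_bounded : ∀ a : ℝ, Bornology.IsBounded {x | x ∈ D.Ω ∧ D.f x ≤ a}
  /- `Lf` bounds the entries of the subgradients on `Ω` -/
  Lf_f : ∀ x ∈ D.Ω, ∀ ξ ∈ subdiff D.f x, ∀ j, |ξ j| ≤ Lf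
  Lf_split : ∀ x ∈ D.Ω, ∀ y ∈ D.Ω, ∀ ξ ∈ subdiff D.fn x + subdiff D.fs y, ∀ j, |ξ j| ≤ Lf
  /- `0 < ν < min {λ₁ / Lf, ϑ}`, with `λ₁ / 0 = ∞` and `ϑ` the least nonzero `|lo j|`, `up j` -/
  ν_pos : 0 < D.ν
  ν_lt : D.ν * Lf < D.lam₁
  ν_lt_lo : ∀ j, D.lo j ≠ 0 → (D.ν : EReal) < -D.lo j
  ν_lt_up : ∀ j, D.up j ≠ 0 → (D.ν : EReal) < D.up j

/-- `x` is an sw-d-stationary point of the relaxation problem `min_{Ω} F`. -/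
def IsSwdStationary (x : Vec n) : Prop :=
  x ∈ D.Ω ∧
    {D.lam₁ • ∑ j, gradient (fun z : Vec n => theta D.ν (D.idxI x j) (z j)) x}
        + D.lam₂ • ∑ l, D.w l •
            subdiff (fun z => theta D.ν (D.idxJ x l).castSucc (D.groupNorm l z)) x
      ⊆ subdiff (D.fbar D.ν) x + normalCone D.Ω x

/-- `x` is a `ν`-strong local minimizer of `min_{Ω} F₀`: a local minimizer whose nonzero entries
have absolute value at least `ν`. -/
def IsStrongLocalMin (x : Vec n) : Prop :=
  x ∈ D.Ω ∧ IsLocalMinOn D.F₀ D.Ω x ∧ ∀ j, x j ≠ 0 → D.ν ≤ |x j|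

end Data

/-- The parameters of the line search algorithm. -/
structure Params where
  ρ : ℝ
  c : ℝ
  αlo : ℝ
  αup : ℝ
  N : ℕ
  K : ℕ
  μbar : ℕ → ℝ

namespace Params

/-- `μ_k = μ̄_k` for `k < K` and `μ_k = ν` for `k ≥ K`. -/
noncomputable def μ (P : Params) (ν : ℝ) (k : ℕ) : ℝ := if k < P.K then P.μbar k else ν

/-- The admissible parameters. -/
structure Valid (P : Params) (ν Ls : ℝ) : Prop where
  ρ_gt : 1 < P.ρ
  c_pos : 0 < P.c
  c_le : P.c ≤ Ls
  αlo_pos : 0 < P.αlo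
  αlo_le : P.αlo ≤ P.αup
  μbar_anti : Antitone P.μbar
  μbar_pred : 0 < P.K → ν ≤ P.μbar (P.K - 1)
  μbar_K : P.μbar P.K ≤ ν

end Params

namespace Data

variable {n L : ℕ} (D : Data n L)

/-- The nonmonotone acceptance test at iteration `k` for the trial point `z`; `k - N` is the
truncated difference. -/
def Accept (P : Params) (x : ℕ → Vec n) (k : ℕ) (z : Vec n) : Prop :=
  D.F (P.μ D.ν k) z ≤
    (Finset.Icc (k - P.N) k).sup' (Finset.nonempty_Icc.mpr (Nat.sub_le k P.N))
        (fun j => D.F (P.μ D.ν k) (x j))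
      - P.c / 2 * ‖z - x k‖ ^ 2

/-- `z` can be produced by one pass through the inner loop of iteration `k`, with the constant `α`:
for some `ξ ∈ ∂Θ_{I^k,J^k}(x^k;μ_k)`, the point `z` solves the strongly convex subproblem. -/
def IsTrial (P : Params) (x : ℕ → Vec n) (k : ℕ) (α : ℝ) (z : Vec n) : Prop :=
  ∃ ξ ∈ subdiff (D.Theta (D.idxI (x k)) (D.idxJ (x k)) (P.μ D.ν k)) (x k),
    IsArgmin
      (fun y => D.model (D.idxI (x k)) (D.idxJ (x k)) ξ (P.μ D.ν k) (x k) (x k) y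
        + α / 2 * ‖y - x k‖ ^ 2)
      D.Ω z

/-- `x` is a sequence of iterates of the DC algorithm with nonmonotone line search: at iteration
`k` an initial constant `αB ∈ [αlo, αup]` is chosen, the trial points for `αB * ρ ^ i`, `i < m`,
are rejected, and the one for `i = m` is accepted and becomes `x (k + 1)`. -/
def IsIterates (P : Params) (x : ℕ → Vec n) : Prop :=
  x 0 ∈ D.Ω ∧
    ∀ k, ∃ αB ∈ Set.Icc P.αlo P.αup, ∃ (m : ℕ) (z : ℕ → Vec n),
      (∀ i ≤ m, D.IsTrial P x k (αB * P.ρ ^ i) (z i)) ∧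
      (∀ i < m, ¬ D.Accept P x k (z i)) ∧
      D.Accept P x k (z m) ∧
      x (k + 1) = z m

end Data

end SparseGroup

/-! The driving fact is a threshold property. Let the final value `ν` of the smoothing parameter be
in force, `|x^k_j| < ν` and `x^{k+1}_j ≠ 0`. Moving `x^{k+1}` towards zero in coordinate `j` saves
`λ₁/ν` per unit length in the ℓ₁ term and costs at most `Lf < λ₁/ν` in the loss; if the step is
short, the group, linearization and proximal terms cost arbitrarily little. So a short step forces
`x^{k+1}_j = 0` (`exists_forall_next_eq_zero`).

Steps do become short: the nonmonotone test makes `F(·;ν)` converge along the iterates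
(`tendsto_step_of_nonmonotone`), and the accepted `α` stay bounded because every `α ≥ 2 Ls + c`
passes the test. Hence each coordinate is eventually zero, eventually at least `ν`, or eventually at
most `-ν` (`eventually_trichotomy`). This yields (i) and the lower bound on the nonzero entries of
accumulation points.

Near an accumulation point `a` the index vectors are eventually those of `a`, and the subproblems
pass to the limit: `a` minimizes `f` over the points of `Ω` supported in the support of `a`
(`isArgmin_f_of_tendsto`). Both parts of (ii) follow. The multiplier of this restricted problem has
entries below `λ₁/ν`, so the kink of the ℓ₁ term absorbs it on the zero entries. A nearby point with
a larger support pays at least `λ₁`, more than `f` can gain locally. -/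

namespace SparseGroup

open Filter Topology
open scoped Pointwise

/-! ### Convex analysis: separation, subgradients, Fermat's rule. -/

/-- Fermat's rule with the Moreau-Rockafellar sum rule for a finite convex function minimized over
a convex set. -/
theorem IsArgmin.exists_subdiff_neg_mem_normalCone {n : ℕ} {g : Vec n → ℝ}
    (hg : ConvexOn ℝ Set.univ g) {S : Set (Vec n)} (hS : Convex ℝ S) {a : Vec n}
    (ha : IsArgmin g S a) : ∃ η ∈ subdiff g a, -η ∈ normalCone S a := by
  have hgc : Continuous g := hg.locallyLipschitz.continuous
  have hA : Convex ℝ {q : Vec n × ℝ | g q.1 < q.2} := by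
    have := hg.convex_strict_epigraph
    simpa using this
  have hAo : IsOpen {q : Vec n × ℝ | g q.1 < q.2} :=
    isOpen_lt (hgc.comp continuous_fst) continuous_snd
  have hB : Convex ℝ (S ×ˢ Set.Iic (g a)) := hS.prod (convex_Iic _)
  have hdisj : Disjoint {q : Vec n × ℝ | g q.1 < q.2} (S ×ˢ Set.Iic (g a)) := by
    rw [Set.disjoint_left]
    rintro ⟨y, t⟩ h1 ⟨h2, h3⟩
    have h4 : g a ≤ g y := ha.2 h2
    simp only [Set.mem_ofPred_eq, Set.mem_Iic] at h1 h3
    linarith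
  -- One separation gives both claims: normalized by its vertical slope `β < 0`, the functional is a
  -- subgradient on the epigraph side and, up to sign, a normal vector on the `S` side.
  obtain ⟨φ, u, h1, h2⟩ := geometric_hahn_banach_open hA hAo hB hdisj
  have hφ : ∀ y t, φ (y, t) = φ (y, 0) + t * φ (0, 1) := by
    intro y t
    have : (y, t) = (y, (0 : ℝ)) + t • ((0 : Vec n), (1 : ℝ)) := by simp
    rw [this, map_add, map_smul, smul_eq_mul]
  set β := φ (0, 1) with hβ
  have hu : u ≤ φ (a, 0) + g a * β := by
    rw [← hφ]; exact h2 _ ⟨ha.1, Set.mem_Iic.mpr le_rfl⟩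
  have hlt : ∀ y, ∀ ε > 0, φ (y, 0) + (g y + ε) * β < u := by
    intro y ε hε
    rw [← hφ]; exact h1 _ (by simpa using hε)
  have hβ0 : β < 0 := by
    have := hlt a 1 one_pos
    linarith
  have hle : ∀ y, φ (y, 0) + g y * β ≤ u := by
    intro y
    refine le_of_forall_pos_lt_add fun ε hε => ?_
    have := hlt y (ε / (-β)) (div_pos hε (neg_pos.mpr hβ0))
    have h3 : ε / (-β) * β = -ε := by
      have := hβ0.ne
      field_simp
    linarith [add_mul (g y) (ε / (-β)) β]
  let ψ : Vec n →L[ℝ] ℝ := φ.comp (ContinuousLinearMap.inl ℝ (Vec n) ℝ)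
  have hψ : ∀ y, φ (y, 0) = ψ y := fun y => rfl
  have hη : ∀ v, inner ℝ ((-β)⁻¹ • (InnerProductSpace.toDual ℝ (Vec n)).symm ψ) v
      = (-β)⁻¹ * ψ v := by
    intro v
    rw [real_inner_smul_left, InnerProductSpace.toDual_symm_apply]
  have hβi : 0 < (-β)⁻¹ := inv_pos.mpr (neg_pos.mpr hβ0)
  refine ⟨(-β)⁻¹ • (InnerProductSpace.toDual ℝ (Vec n)).symm ψ, fun y => ?_, fun y hy => ?_⟩
  · rw [hη, map_sub]
    have h3 := hle y
    rw [hψ] at h3 hu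
    have h4 : ψ y - ψ a ≤ (g y - g a) * (-β) := by linarith
    have h5 := mul_le_mul_of_nonneg_left h4 hβi.le
    have h6 : (-β)⁻¹ * ((g y - g a) * (-β)) = g y - g a := by
      have := hβ0.ne
      field_simp
    linarith
  · rw [inner_neg_left, hη, map_sub]
    have h3 : u ≤ φ (y, 0) + g a * β := by
      rw [← hφ]; exact h2 _ ⟨hy, Set.mem_Iic.mpr le_rfl⟩
    have h4 := hle a
    rw [hψ] at h3 h4
    have : 0 ≤ (-β)⁻¹ * (ψ y - ψ a) := mul_nonneg hβi.le (by linarith)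
    linarith

theorem subdiff_nonempty {n : ℕ} {g : Vec n → ℝ} (hg : ConvexOn ℝ Set.univ g) (a : Vec n) :
    (subdiff g a).Nonempty := by
  have ha : IsArgmin g {a} a := ⟨rfl, by simp [IsMinOn, IsMinFilter]⟩
  obtain ⟨η, hη, -⟩ := ha.exists_subdiff_neg_mem_normalCone hg (convex_singleton a)
  exact ⟨η, hη⟩

theorem gradient_mem_subdiff {n : ℕ} {g : Vec n → ℝ} (hg : ConvexOn ℝ Set.univ g) {a : Vec n}
    (hd : DifferentiableAt ℝ g a) : gradient g a ∈ subdiff g a := by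
  intro y
  have hl : HasDerivAt (fun t : ℝ => a + t • (y - a)) (y - a) 0 := by
    simpa using ((hasDerivAt_id (0 : ℝ)).smul_const (y - a)).const_add a
  have hgd : HasFDerivAt g (InnerProductSpace.toDual ℝ (Vec n) (gradient g a))
      (a + (0 : ℝ) • (y - a)) := by
    simpa using hd.hasGradientAt.hasFDerivAt
  have h1 : HasDerivAt (fun t : ℝ => g (a + t • (y - a))) (inner ℝ (gradient g a) (y - a)) 0 := by
    exact hgd.comp_hasDerivAt (0 : ℝ) hl
  have hc : ConvexOn ℝ Set.univ (fun t : ℝ => g (a + t • (y - a))) := by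
    have := hg.comp_affineMap (AffineMap.lineMap (k := ℝ) a y)
    simpa [Function.comp_def, AffineMap.lineMap_apply, add_comm] using this
  have := hc.le_slope_of_hasDerivAt (Set.mem_univ 0) (Set.mem_univ 1) zero_lt_one h1
  simp only [slope_def_field, one_smul, zero_smul, add_zero, sub_zero, div_one,
    add_sub_cancel] at this
  linarith

/-! ### Vanishing steps of nonmonotone descent. -/

/-- A line search with a nonmonotone acceptance test produces vanishing steps. -/
theorem tendsto_step_of_nonmonotone {E : Type*} [SeminormedAddCommGroup E] {φ : E → ℝ} {x : ℕ → E}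
    {N K : ℕ} {c : ℝ} (hc : 0 < c)
    (hdec : ∀ k ≥ K, φ (x (k + 1)) ≤
      (Finset.Icc (k - N) k).sup' (Finset.nonempty_Icc.mpr (Nat.sub_le k N)) (fun j => φ (x j))
        - c / 2 * ‖x (k + 1) - x k‖ ^ 2)
    (hbdd : ∃ b, ∀ k, b ≤ φ (x k))
    (huc : ∀ ε > 0, ∃ δ > 0, ∀ k, ‖x (k + 1) - x k‖ < δ → φ (x (k + 1)) - ε ≤ φ (x k)) :
    Tendsto (fun k => ‖x (k + 1) - x k‖) atTop (𝓝 0) := by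
  set M : ℕ → ℝ := fun k => (Finset.Icc (k - N) k).sup'
    (Finset.nonempty_Icc.mpr (Nat.sub_le k N)) (fun j => φ (x j)) with hM
  have hle : ∀ k j, k - N ≤ j → j ≤ k → φ (x j) ≤ M k := fun k j h1 h2 =>
    Finset.le_sup' (fun j => φ (x j)) (Finset.mem_Icc.mpr ⟨h1, h2⟩)
  have hsq : ∀ k, 0 ≤ c / 2 * ‖x (k + 1) - x k‖ ^ 2 := fun k => by positivity
  have hanti : ∀ k ≥ K, M (k + 1) ≤ M k := by
    intro k hk
    refine Finset.sup'_le _ _ fun j hj => ?_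
    rw [Finset.mem_Icc] at hj
    rcases Nat.lt_or_ge k j with h | h
    · obtain rfl : j = k + 1 := by omega
      have := hdec k hk
      have := hsq k
      simp only [hM]
      linarith
    · exact hle k j (by omega) h
  obtain ⟨b, hb⟩ := hbdd
  have hA : Antitone fun k => M (k + K) := antitone_nat_of_succ_le fun k => by
    have := hanti (k + K) (by omega)
    rwa [show k + 1 + K = k + K + 1 by omega]
  have hbb : BddBelow (Set.range fun k => M (k + K)) := by
    refine ⟨b, ?_⟩
    rintro _ ⟨k, rfl⟩
    exact (hb _).trans (hle _ (k + K) (by omega) le_rfl)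
  obtain ⟨m, hm⟩ : ∃ m, Tendsto (fun k => M (k + K)) atTop (𝓝 m) := ⟨_, tendsto_atTop_ciInf hA hbb⟩
  have hmle : ∀ k ≥ K, m ≤ M k := by
    intro k hk
    have := hA.le_of_tendsto hm (k - K)
    simpa [Nat.sub_add_cancel hk] using this
  have hMm : ∀ ε > 0, ∃ k₀ ≥ K, ∀ k ≥ k₀, M k ≤ m + ε := by
    intro ε hε
    have h1 : Tendsto M atTop (𝓝 m) := (tendsto_add_atTop_iff_nat K).mp hm
    obtain ⟨k₀, h⟩ := eventually_atTop.mp (h1.eventually (gt_mem_nhds (lt_add_of_pos_right m hε)))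
    exact ⟨max k₀ K, le_max_right _ _, fun k hk => (h k ((le_max_left _ _).trans hk)).le⟩
  -- Values near `m` propagate backwards: if `φ (x (k + 1))` is close to `m`, then since `M k` is
  -- too, the test forces a short step, and `huc` carries the bound to `φ (x k)`.
  have hback : ∀ i : ℕ, ∀ ε > 0, ∃ δ > 0, ∃ k₀, ∀ k ≥ k₀, ∀ i' ≤ i,
      m - δ ≤ φ (x (k + i')) → m - ε ≤ φ (x k) := by
    intro i
    induction i with
    | zero =>
      intro ε hε
      refine ⟨ε, hε, 0, fun k _ i' hi' h => ?_⟩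
      obtain rfl : i' = 0 := by omega
      exact h
    | succ i ih =>
      intro ε hε
      obtain ⟨δ₁, hδ₁, h1⟩ := huc (ε / 2) (half_pos hε)
      -- With errors `c/8 * δ₁²` on both sides of `m`, the test gives a squared step of at most
      -- `δ₁²/2`.
      have hη : 0 < min (ε / 2) (c / 8 * δ₁ ^ 2) := lt_min (half_pos hε) (by positivity)
      obtain ⟨δ, hδ, k₁, h2⟩ := ih _ hη
      obtain ⟨k₂, hk₂, h3⟩ := hMm _ hη
      refine ⟨min δ ε, lt_min hδ hε, max k₁ k₂, fun k hk i' hi' h => ?_⟩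
      have hk1 : k₁ ≤ k := (le_max_left _ _).trans hk
      have hk2 : k₂ ≤ k := (le_max_right _ _).trans hk
      rcases Nat.eq_zero_or_pos i' with rfl | hpos
      · have := min_le_right δ ε
        simp only [add_zero] at h
        linarith
      · obtain ⟨i'', rfl⟩ : ∃ i'', i' = i'' + 1 := ⟨i' - 1, by omega⟩
        have h4 := h2 (k + 1) (by omega) i'' (by omega) (by
          rw [show k + 1 + i'' = k + (i'' + 1) by omega]
          have := min_le_left δ ε
          linarith)
        have h5 := hdec k (by omega)
        have h6 := h3 k hk2
        have h7 : ‖x (k + 1) - x k‖ < δ₁ := by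
          refine lt_of_pow_lt_pow_left₀ 2 hδ₁.le ?_
          have h8 := min_le_right (ε / 2) (c / 8 * δ₁ ^ 2)
          have h9 : c / 2 * ‖x (k + 1) - x k‖ ^ 2 ≤ c / 4 * δ₁ ^ 2 := by
            simp only [hM] at h6
            linarith
          have h10 : 0 < c * δ₁ ^ 2 := by positivity
          nlinarith
        have h8 := h1 k h7
        have h9 := min_le_left (ε / 2) (c / 8 * δ₁ ^ 2)
        linarith
  have hlow : ∀ ε > 0, ∃ k₀, ∀ k ≥ k₀, m - ε ≤ φ (x k) := by
    intro ε hε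
    obtain ⟨δ, hδ, k₀, h⟩ := hback N ε hε
    refine ⟨max k₀ K, fun k hk => ?_⟩
    -- The window ending at `k + N` starts at `k`, so its maximizer lies at most `N` steps ahead of
    -- `k`, within reach of `hback N`.
    obtain ⟨l, hl, hl'⟩ := Finset.exists_mem_eq_sup' (Finset.nonempty_Icc.mpr
      (Nat.sub_le (k + N) N)) (fun j => φ (x j))
    rw [Finset.mem_Icc] at hl
    refine h k ((le_max_left _ _).trans hk) (l - k) (by omega) ?_
    have h1 := hmle (k + N) ((le_max_right k₀ K).trans (by omega))
    simp only [hM, hl'] at h1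
    rw [show k + (l - k) = l by omega]
    linarith
  rw [Metric.tendsto_atTop]
  intro ε hε
  have hη : 0 < c / 8 * ε ^ 2 := by positivity
  obtain ⟨k₁, h1⟩ := hlow _ hη
  obtain ⟨k₂, hk₂, h2⟩ := hMm _ hη
  refine ⟨max k₁ k₂, fun k hk => ?_⟩
  have hk1 : k₁ ≤ k := (le_max_left _ _).trans hk
  have hk2 : k₂ ≤ k := (le_max_right _ _).trans hk
  have h3 := h1 (k + 1) (by omega)
  have h4 := h2 k hk2
  have h5 := hdec k (by omega)
  simp only [hM] at h4
  rw [dist_zero_right, norm_norm]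
  refine lt_of_pow_lt_pow_left₀ 2 hε.le ?_
  have h6 : c / 2 * ‖x (k + 1) - x k‖ ^ 2 ≤ c / 4 * ε ^ 2 := by linarith
  have : 0 < c * ε ^ 2 := by positivity
  nlinarith


/-! ### Affine pieces and estimates for Euclidean norms. -/

@[simp] theorem theta_zero (μ t : ℝ) : theta μ 0 t = 0 := rfl

@[simp] theorem theta_one (μ t : ℝ) : theta μ 1 t = t / μ - 1 := rfl

@[simp] theorem theta_two (μ t : ℝ) : theta μ 2 t = -t / μ - 1 := rfl

theorem lastArgmax_eq {m : ℕ} {φ : Fin (m + 1) → ℝ} {i : Fin (m + 1)} (hi : ∀ i', φ i' ≤ φ i)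
    (hlast : ∀ i', i < i' → φ i' < φ i) : lastArgmax φ = i := by
  classical
  unfold lastArgmax
  refine le_antisymm (Finset.sup_le fun i' hi' => ?_) ?_
  · by_contra h
    have h1 := hlast i' (not_le.mp h)
    have h2 := (Finset.mem_filter.mp hi').2 i
    linarith
  · exact Finset.le_sup (f := id) (Finset.mem_filter.mpr ⟨Finset.mem_univ _, hi⟩)

/-- Difference quotients of a norm at nearby points, in the same direction, are close. -/
theorem norm_add_sub_norm_sub_le {E : Type*} [NormedAddCommGroup E] [InnerProductSpace ℝ E]
    {u v e : E} {ν δ s : ℝ} (hν : 0 < ν) (hu : ν ≤ ‖u‖) (huv : ‖v - u‖ ≤ δ) (hs : 0 ≤ s)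
    (hsδ : s ≤ δ) (hδ : δ ≤ ν / 2) (he : ‖e‖ ≤ 1) :
    (‖u + s • e‖ - ‖u‖) - (‖v‖ - ‖v - s • e‖) ≤ s * (12 * δ / ν) := by
  -- `‖w‖⁻¹ • w` is a subgradient of the norm at every `w`; at `w = 0` the convention `0⁻¹ = 0`
  -- makes it the zero vector. This covers a vanishing `V` below.
  have key : ∀ w z : E, inner ℝ (‖w‖⁻¹ • w) z ≤ ‖z‖ := by
    intro w z
    refine (real_inner_le_norm _ _).trans ?_
    refine mul_le_of_le_one_left (norm_nonneg z) ?_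
    rw [norm_smul, norm_inv, norm_norm]
    exact inv_mul_le_one
  have self : ∀ w : E, inner ℝ (‖w‖⁻¹ • w) w = ‖w‖ := by
    intro w
    rw [real_inner_smul_left, real_inner_self_eq_norm_sq]
    rcases eq_or_ne ‖w‖ 0 with h | h
    · simp [h]
    · field_simp
  set U := u + s • e with hU
  set V := v - s • e with hV
  have hse : ‖s • e‖ ≤ s := by
    rw [norm_smul, Real.norm_of_nonneg hs]
    exact mul_le_of_le_one_right hs he
  have h1 : ‖U‖ - ‖u‖ ≤ s * inner ℝ (‖U‖⁻¹ • U) e := by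
    have h2 := key U u
    have h3 : u = U - s • e := by simp [hU]
    conv at h2 => lhs; rw [h3]
    rw [inner_sub_right, self, real_inner_smul_right] at h2
    linarith
  have h2 : s * inner ℝ (‖V‖⁻¹ • V) e ≤ ‖v‖ - ‖V‖ := by
    have h2 := key V v
    have h3 : v = V + s • e := by simp [hV]
    conv at h2 => lhs; rw [h3]
    rw [inner_add_right, self, real_inner_smul_right] at h2
    linarith
  have hUV : ‖U - V‖ ≤ 3 * δ := by
    have : U - V = (u - v) + (s • e + s • e) := by simp only [hU, hV]; abel
    rw [this]
    have h3 := norm_add_le (u - v) (s • e + s • e)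
    have h4 := norm_add_le (s • e) (s • e)
    rw [norm_sub_rev] at huv
    linarith
  have hUn : ν / 2 ≤ ‖U‖ := by
    have := norm_sub_le_norm_add u (s • e)
    linarith
  have hU0 : 0 < ‖U‖ := by linarith
  have h3 : ‖‖U‖⁻¹ • U - ‖V‖⁻¹ • V‖ ≤ 2 * ‖U - V‖ / ‖U‖ := by
    have h4 : ‖U‖⁻¹ • U - ‖V‖⁻¹ • V = ‖U‖⁻¹ • (U - V) + (‖U‖⁻¹ - ‖V‖⁻¹) • V := by
      module
    have h5 : ‖(‖U‖⁻¹ - ‖V‖⁻¹) • V‖ ≤ ‖U - V‖ / ‖U‖ := by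
      rcases eq_or_ne V 0 with h | h
      · rw [h]; simp; positivity
      · have hV0 : 0 < ‖V‖ := norm_pos_iff.mpr h
        have h6 : ‖U‖⁻¹ - ‖V‖⁻¹ = (‖V‖ - ‖U‖) / (‖U‖ * ‖V‖) := by field_simp
        rw [norm_smul, h6, norm_div, Real.norm_eq_abs, Real.norm_of_nonneg (by positivity)]
        have h7 : |‖V‖ - ‖U‖| ≤ ‖U - V‖ := by
          rw [norm_sub_rev U V]; exact abs_norm_sub_norm_le V U
        have h8 : |‖V‖ - ‖U‖| / (‖U‖ * ‖V‖) * ‖V‖ = |‖V‖ - ‖U‖| / ‖U‖ := by field_simp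
        rw [h8]
        gcongr
    have h6 : ‖‖U‖⁻¹ • (U - V)‖ = ‖U - V‖ / ‖U‖ := by
      rw [norm_smul, norm_inv, norm_norm]; ring
    rw [h4]
    refine (norm_add_le _ _).trans ?_
    rw [h6, mul_div_assoc]
    linarith
  -- `12` comes from `‖U - V‖ ≤ 3δ` and `‖U‖ ≥ ν/2`.
  have h4 : 2 * ‖U - V‖ / ‖U‖ ≤ 12 * δ / ν := by
    rw [div_le_div_iff₀ hU0 hν]
    have := norm_nonneg (U - V)
    nlinarith
  have h5 : inner ℝ (‖U‖⁻¹ • U - ‖V‖⁻¹ • V) e ≤ 12 * δ / ν := by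
    refine (real_inner_le_norm _ _).trans ?_
    refine (mul_le_of_le_one_right (norm_nonneg _) he).trans (h3.trans h4)
  rw [inner_sub_left] at h5
  have := mul_le_mul_of_nonneg_left h5 hs
  rw [mul_sub] at this
  linarith

/-- Follows from the parallelogram law after bounding each norm `r` by `(r² + ‖u‖²) / (2‖u‖)`. -/
theorem norm_add_add_norm_sub_le {E : Type*} [NormedAddCommGroup E] [InnerProductSpace ℝ E]
    {u : E} (hu : u ≠ 0) (v : E) :
    ‖u + v‖ + ‖u - v‖ ≤ 2 * ‖u‖ + ‖v‖ ^ 2 / ‖u‖ := by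
  have h0 : 0 < ‖u‖ := norm_pos_iff.mpr hu
  have h1 := norm_add_sq_real u v
  have h2 := norm_sub_sq_real u v
  have h3 : ∀ r : ℝ, r ≤ (r ^ 2 + ‖u‖ ^ 2) / (2 * ‖u‖) := by
    intro r
    rw [le_div_iff₀ (by positivity)]
    nlinarith [sq_nonneg (r - ‖u‖)]
  have h4 := add_le_add (h3 ‖u + v‖) (h3 ‖u - v‖)
  rw [h1, h2] at h4
  refine h4.trans (le_of_eq ?_)
  field_simp
  ring

/-! ### Group norms for `p = 1` and `p = 2`. -/

namespace Data

variable {n L : ℕ} {D : Data n L}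

theorem groupNorm_of_p_eq_one (hp : D.p = 1) (l : Fin L) (x : Vec n) :
    D.groupNorm l x = ∑ j ∈ D.G l, |x j| := by
  -- The type of the vector depends on the exponent, so the exponent is generalized before it is
  -- substituted.
  have : ∀ q : ENNReal, q = 1 → ‖(WithLp.toLp q fun j : D.G l => x j :
      PiLp q fun _ : D.G l => ℝ)‖ = ∑ j ∈ D.G l, |x j| := by
    rintro q rfl
    rw [PiLp.norm_eq_of_L1]
    simp only [Real.norm_eq_abs]
    exact Finset.sum_coe_sort (D.G l) fun j => |x j|
  exact this D.p hp

/-- The restriction of a vector to a group of coordinates. -/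
noncomputable def restrict (D : Data n L) (l : Fin L) : Vec n →ₗ[ℝ] EuclideanSpace ℝ (D.G l) where
  toFun x := WithLp.toLp 2 fun j => x j
  map_add' _ _ := rfl
  map_smul' _ _ := rfl

theorem norm_restrict (l : Fin L) (x : Vec n) : ‖D.restrict l x‖ = √(∑ j ∈ D.G l, |x j| ^ 2) := by
  rw [EuclideanSpace.norm_eq]
  congr 1
  exact Finset.sum_coe_sort (D.G l) fun j => ‖x j‖ ^ 2

theorem norm_restrict_le (l : Fin L) (x : Vec n) : ‖D.restrict l x‖ ≤ ‖x‖ := by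
  rw [norm_restrict, EuclideanSpace.norm_eq]
  exact Real.sqrt_le_sqrt (Finset.sum_le_univ_sum_of_nonneg fun j => sq_nonneg _)

theorem groupNorm_of_p_eq_two (hp : D.p = 2) (l : Fin L) (x : Vec n) :
    D.groupNorm l x = ‖D.restrict l x‖ := by
  have : ∀ q : ENNReal, q = 2 → ‖(WithLp.toLp q fun j : D.G l => x j :
      PiLp q fun _ : D.G l => ℝ)‖ = ‖D.restrict l x‖ := by
    rintro q rfl
    rfl
  exact this D.p hp

theorem continuous_groupNorm (hp : D.p = 1 ∨ D.p = 2) (l : Fin L) :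
    Continuous (D.groupNorm l) := by
  rcases hp with hp | hp
  · have : D.groupNorm l = fun x => ∑ j ∈ D.G l, |x j| := funext (groupNorm_of_p_eq_one hp l)
    rw [this]
    fun_prop
  · have : D.groupNorm l = fun x => ‖D.restrict l x‖ := funext (groupNorm_of_p_eq_two hp l)
    rw [this]
    exact (LinearMap.continuous_of_finiteDimensional _).norm

theorem groupNorm_le_groupNorm (hp : D.p = 1 ∨ D.p = 2) {l : Fin L} {x y : Vec n}
    (h : ∀ j ∈ D.G l, |x j| ≤ |y j|) : D.groupNorm l x ≤ D.groupNorm l y := by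
  rcases hp with hp | hp
  · simp only [groupNorm_of_p_eq_one hp]
    exact Finset.sum_le_sum h
  · simp only [groupNorm_of_p_eq_two hp, norm_restrict]
    refine Real.sqrt_le_sqrt (Finset.sum_le_sum fun j hj => ?_)
    exact pow_le_pow_left₀ (abs_nonneg _) (h j hj) 2

theorem groupNorm_zero (hp : D.p = 1 ∨ D.p = 2) (l : Fin L) : D.groupNorm l 0 = 0 := by
  rcases hp with hp | hp
  · simp [groupNorm_of_p_eq_one hp]
  · simp [groupNorm_of_p_eq_two hp]

theorem groupNorm_nonneg (hp : D.p = 1 ∨ D.p = 2) (l : Fin L) (x : Vec n) :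
    0 ≤ D.groupNorm l x := by
  rw [← groupNorm_zero hp l]
  exact groupNorm_le_groupNorm hp fun j _ => by simp

theorem groupNorm_eq_zero (hp : D.p = 1 ∨ D.p = 2) {l : Fin L} {x : Vec n}
    (h : ∀ j ∈ D.G l, x j = 0) : D.groupNorm l x = 0 := by
  refine le_antisymm ?_ (groupNorm_nonneg hp l x)
  rw [← groupNorm_zero hp l]
  exact groupNorm_le_groupNorm hp fun j hj => by simp [h j hj]

theorem abs_le_groupNorm (hp : D.p = 1 ∨ D.p = 2) {l : Fin L} (x : Vec n) {j : Fin n}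
    (hj : j ∈ D.G l) : |x j| ≤ D.groupNorm l x := by
  rcases hp with hp | hp
  · rw [groupNorm_of_p_eq_one hp]
    exact Finset.single_le_sum (f := fun j => |x j|) (fun _ _ => abs_nonneg _) hj
  · rw [groupNorm_of_p_eq_two hp]
    exact PiLp.norm_apply_le (D.restrict l x) ⟨j, hj⟩

/-- The hypothesis `hy` says that subtracting `s • e` shrinks the entries of `y` without crossing
zero. The growth of the norm at `x` is then almost cancelled by its decrease at `y`: for `p = 1` by
the triangle inequality with no error, for `p = 2` because the norm is smooth away from zero. -/
theorem groupNorm_step_le (hp : D.p = 1 ∨ D.p = 2) {l : Fin L} {x y e : Vec n} {δ s ν : ℝ}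
    (hν : 0 < ν) (hx : ν ≤ D.groupNorm l x) (hxy : ‖y - x‖ ≤ δ) (hs : 0 ≤ s) (hsδ : s ≤ δ)
    (hδ : δ ≤ ν / 2) (he : ‖e‖ ≤ 1) (hy : ∀ j, |y j - s * e j| = |y j| - s * |e j|) :
    (D.groupNorm l (x + s • e) - D.groupNorm l x)
      - (D.groupNorm l y - D.groupNorm l (y - s • e)) ≤ s * (12 * δ / ν) := by
  have hδ0 : 0 ≤ δ := hs.trans hsδ
  rcases hp with hp | hp
  · simp only [groupNorm_of_p_eq_one hp, ← Finset.sum_sub_distrib]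
    refine (Finset.sum_nonpos fun j _ => ?_).trans (by positivity)
    have h1 := abs_add_le (x j) (s * e j)
    rw [abs_mul, abs_of_nonneg hs] at h1
    simp only [PiLp.add_apply, PiLp.sub_apply, PiLp.smul_apply, smul_eq_mul, hy]
    linarith
  · simp only [groupNorm_of_p_eq_two hp, map_add, map_sub, map_smul] at hx ⊢
    refine norm_add_sub_norm_sub_le hν hx ?_ hs hsδ hδ ((norm_restrict_le l e).trans he)
    rw [← map_sub]
    exact (norm_restrict_le l _).trans hxy

/-- Along directions supported in the support of `a`, the group norms have second differences of
second order at `a`. -/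
theorem groupNorm_second_difference (hp : D.p = 1 ∨ D.p = 2) (l : Fin L) {a d : Vec n}
    (hd : ∀ j, a j = 0 → d j = 0) :
    ∃ C, 0 ≤ C ∧ ∀ᶠ t : ℝ in 𝓝[>] 0,
      D.groupNorm l (a + t • d) + D.groupNorm l (a - t • d) - 2 * D.groupNorm l a ≤ C * t ^ 2 := by
  rcases hp with hp | hp
  · refine ⟨0, le_rfl, ?_⟩
    have h1 : ∀ j, ∀ᶠ t : ℝ in 𝓝[>] 0, |t * d j| ≤ |a j| := by
      intro j
      by_cases hj : a j = 0
      · exact Eventually.of_forall fun t => by simp [hj, hd j hj]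
      · refine nhdsWithin_le_nhds ?_
        have hc : Tendsto (fun t : ℝ => |t * d j|) (𝓝 0) (𝓝 0) := by
          have : Continuous fun t : ℝ => |t * d j| := by fun_prop
          simpa using this.tendsto 0
        exact hc.eventually (ge_mem_nhds (abs_pos.mpr hj))
    filter_upwards [eventually_all.mpr h1] with t ht
    simp only [groupNorm_of_p_eq_one hp, Finset.mul_sum, ← Finset.sum_add_distrib,
      ← Finset.sum_sub_distrib, zero_mul]
    refine Finset.sum_nonpos fun j _ => ?_
    simp only [PiLp.add_apply, PiLp.sub_apply, PiLp.smul_apply, smul_eq_mul]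
    have h2 := abs_le.mp (ht j)
    rcases abs_cases (a j) with ⟨h3, h4⟩ | ⟨h3, h4⟩
    · rw [abs_of_nonneg (by linarith : 0 ≤ a j + t * d j),
        abs_of_nonneg (by linarith : 0 ≤ a j - t * d j)]
      linarith
    · rw [abs_of_nonpos (by linarith : a j + t * d j ≤ 0),
        abs_of_nonpos (by linarith : a j - t * d j ≤ 0)]
      linarith
  · simp only [groupNorm_of_p_eq_two hp, map_add, map_sub, map_smul]
    by_cases h : D.restrict l a = 0
    · refine ⟨0, le_rfl, Eventually.of_forall fun t => ?_⟩
      have h1 : D.restrict l d = 0 := by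
        ext j
        have h2 : (D.restrict l a) j = 0 := by rw [h]; rfl
        exact hd j h2
      simp [h, h1]
    · refine ⟨‖D.restrict l d‖ ^ 2 / ‖D.restrict l a‖, by positivity, Eventually.of_forall fun t => ?_⟩
      have := norm_add_add_norm_sub_le h (t • D.restrict l d)
      rw [norm_smul, mul_pow, Real.norm_eq_abs, sq_abs, mul_comm, mul_div_assoc] at this
      rw [mul_comm (_ / _)]
      linarith

/-! ### Active indices in terms of the threshold `ν`. -/

theorem idxI_of_abs_lt (hν : 0 < D.ν) {x : Vec n} {j : Fin n} (h : |x j| < D.ν) : D.idxI x j = 0 := by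
  obtain ⟨h1, h2⟩ := abs_lt.mp h
  have h3 : x j / D.ν < 1 := (div_lt_one hν).mpr h2
  have h4 : -x j / D.ν < 1 := (div_lt_one hν).mpr (by linarith)
  refine lastArgmax_eq ?_ ?_
  · simp only [Fin.forall_fin_succ, Fin.forall_fin_zero]
    refine ⟨le_rfl, ?_, ?_, trivial⟩ <;> simp [theta] <;> linarith
  · intro i hi
    fin_cases i
    · simp at hi
    · simp [theta]; linarith
    · simp [theta]; linarith

/-- At `x j = D.ν` two pieces tie and the largest index wins, so equality belongs to this case and
not to the zero piece. -/
theorem idxI_of_le (hν : 0 < D.ν) {x : Vec n} {j : Fin n} (h : D.ν ≤ x j) : D.idxI x j = 1 := by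
  have h3 : 1 ≤ x j / D.ν := (one_le_div hν).mpr h
  have h4 : -x j / D.ν < 1 := (div_lt_one hν).mpr (by linarith)
  rw [neg_div] at h4
  refine lastArgmax_eq ?_ ?_
  · simp only [Fin.forall_fin_succ, Fin.forall_fin_zero]
    refine ⟨?_, ?_, ?_, trivial⟩ <;> simp [theta, neg_div] <;> linarith
  · intro i hi
    fin_cases i
    · simp at hi
    · simp at hi
    · simp [theta, neg_div]; linarith

theorem idxI_of_le_neg (hν : 0 < D.ν) {x : Vec n} {j : Fin n} (h : x j ≤ -D.ν) : D.idxI x j = 2 := by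
  have h3 : 1 ≤ -x j / D.ν := (one_le_div hν).mpr (by linarith)
  have h4 : x j / D.ν < 1 := (div_lt_one hν).mpr (by linarith)
  rw [neg_div] at h3
  refine lastArgmax_eq ?_ ?_
  · simp only [Fin.forall_fin_succ, Fin.forall_fin_zero]
    refine ⟨?_, ?_, ?_, trivial⟩ <;> simp [theta, neg_div] <;> linarith
  · intro i hi
    fin_cases i <;> simp at hi

theorem idxJ_of_lt (hν : 0 < D.ν) {x : Vec n} {l : Fin L} (h : D.groupNorm l x < D.ν) : D.idxJ x l = 0 := by
  have h3 : D.groupNorm l x / D.ν < 1 := (div_lt_one hν).mpr h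
  refine lastArgmax_eq ?_ ?_
  · simp only [Fin.forall_fin_succ, Fin.forall_fin_zero]
    refine ⟨le_rfl, ?_, trivial⟩
    simp [theta]; linarith
  · intro i hi
    fin_cases i
    · simp at hi
    · simp [theta]; linarith

theorem idxJ_of_le (hν : 0 < D.ν) {x : Vec n} {l : Fin L} (h : D.ν ≤ D.groupNorm l x) : D.idxJ x l = 1 := by
  have h3 : 1 ≤ D.groupNorm l x / D.ν := (one_le_div hν).mpr h
  refine lastArgmax_eq ?_ ?_
  · simp only [Fin.forall_fin_succ, Fin.forall_fin_zero]
    refine ⟨?_, ?_, trivial⟩ <;> simp [theta]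
    linarith
  · intro i hi
    fin_cases i <;> simp at hi

end Data


theorem le_lastArgmax {m : ℕ} (φ : Fin (m + 1) → ℝ) (i : Fin (m + 1)) :
    φ i ≤ φ (lastArgmax φ) := by
  classical
  obtain ⟨i₀, -, h₀⟩ := Finset.exists_max_image Finset.univ φ Finset.univ_nonempty
  have hne : (Finset.univ.filter fun i => ∀ i', φ i' ≤ φ i).Nonempty :=
    ⟨i₀, Finset.mem_filter.mpr ⟨Finset.mem_univ _, fun i' => h₀ i' (Finset.mem_univ _)⟩⟩
  obtain ⟨i₁, h₁, h₂⟩ := Finset.exists_mem_eq_sup _ hne id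
  have : lastArgmax φ = i₁ := by
    rw [← id_def i₁, ← h₂]
    unfold lastArgmax
    congr
  rw [this]
  exact (Finset.mem_filter.mp h₁).2 i

theorem theta_le_max {μ t : ℝ} (i : Fin 3) :
    theta μ i t ≤ max (max (theta μ 0 t) (theta μ 1 t)) (theta μ 2 t) := by
  fin_cases i <;> simp

theorem theta_castSucc_le_max {μ t : ℝ} (i : Fin 2) :
    theta μ i.castSucc t ≤ max (theta μ 0 t) (theta μ 1 t) := by
  fin_cases i <;> simp

theorem theta_le_abs_div {μ : ℝ} (hμ : 0 < μ) (i : Fin 3) (t : ℝ) : theta μ i t ≤ |t| / μ := by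
  have h1 : t / μ ≤ |t| / μ := by gcongr; exact le_abs_self t
  have h2 : -t / μ ≤ |t| / μ := by gcongr; exact neg_le_abs t
  have h3 : 0 ≤ |t| / μ := by positivity
  fin_cases i <;> simp <;> linarith

theorem continuous_theta (μ : ℝ) (i : Fin 3) : Continuous (theta μ i) := by
  fin_cases i
  · exact continuous_const
  · exact (continuous_id.div_const μ).sub continuous_const
  · exact (continuous_neg.div_const μ).sub continuous_const

/-! ### The relaxed objective as a difference of convex functions. -/

namespace Data

variable {n L : ℕ} {D : Data n L}

theorem max_theta_eq_idxI (x : Vec n) (j : Fin n) :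
    max (max (theta D.ν 0 (x j)) (theta D.ν 1 (x j))) (theta D.ν 2 (x j))
      = theta D.ν (D.idxI x j) (x j) :=
  le_antisymm (max_le (max_le (le_lastArgmax (fun i => theta D.ν i (x j)) 0)
    (le_lastArgmax (fun i => theta D.ν i (x j)) 1)) (le_lastArgmax (fun i => theta D.ν i (x j)) 2))
    (theta_le_max _)

theorem max_theta_eq_idxJ (x : Vec n) (l : Fin L) :
    max (theta D.ν 0 (D.groupNorm l x)) (theta D.ν 1 (D.groupNorm l x))
      = theta D.ν (D.idxJ x l).castSucc (D.groupNorm l x) :=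
  le_antisymm (max_le
    (le_lastArgmax (fun i : Fin 2 => theta D.ν i.castSucc (D.groupNorm l x)) 0)
    (le_lastArgmax (fun i : Fin 2 => theta D.ν i.castSucc (D.groupNorm l x)) 1))
    (theta_castSucc_le_max _)

theorem F_eq (x : Vec n) :
    D.F D.ν x = D.fbar D.ν x - D.Theta (D.idxI x) (D.idxJ x) D.ν x := by
  simp only [F, Theta, max_theta_eq_idxI, max_theta_eq_idxJ]
  ring

theorem convex_Ω : Convex ℝ D.Ω := by
  have h : ∀ j, Convex ℝ {t : ℝ | D.lo j ≤ (t : EReal) ∧ (t : EReal) ≤ D.up j} := by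
    intro j
    refine Set.OrdConnected.convex ⟨?_⟩
    rintro s ⟨hs, -⟩ t ⟨-, ht⟩ r ⟨hr1, hr2⟩
    exact ⟨hs.trans (by exact_mod_cast hr1), le_trans (by exact_mod_cast hr2) ht⟩
  intro x hx y hy a b ha hb hab j
  exact h j (hx j) (hy j) ha hb hab

theorem isClosed_Ω : IsClosed D.Ω := by
  have : D.Ω = ⋂ j, {x : Vec n | D.lo j ≤ (x j : EReal) ∧ (x j : EReal) ≤ D.up j} := by
    ext x
    simp [Ω]
  rw [this]
  refine isClosed_iInter fun j => ?_
  have hc : Continuous fun x : Vec n => ((x j : ℝ) : EReal) :=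
    continuous_coe_real_ereal.comp (by fun_prop)
  exact (isClosed_le continuous_const hc).inter (isClosed_le hc continuous_const)

namespace Assumptions

variable {Lf Ls : ℝ} (hD : D.Assumptions Lf Ls)
include hD

/-- Any choice of pieces majorizes `F`; by `F_eq` the active pieces at `x` with `μ = ν` touch it at
`x`. This is the source of descent. -/
theorem F_le (I : Fin n → Fin 3) (J : Fin L → Fin 2) (μ : ℝ) (x : Vec n) :
    D.F μ x ≤ D.fbar μ x - D.Theta I J μ x := by
  have h1 : D.lam₁ * ∑ j, theta μ (I j) (x j) ≤
      D.lam₁ * ∑ j, max (max (theta μ 0 (x j)) (theta μ 1 (x j))) (theta μ 2 (x j)) :=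
    mul_le_mul_of_nonneg_left (Finset.sum_le_sum fun j _ => theta_le_max _) hD.lam₁_pos.le
  have h2 : D.lam₂ * ∑ l, D.w l * theta μ (J l).castSucc (D.groupNorm l x) ≤
      D.lam₂ * ∑ l, D.w l * max (theta μ 0 (D.groupNorm l x)) (theta μ 1 (D.groupNorm l x)) :=
    mul_le_mul_of_nonneg_left (Finset.sum_le_sum fun l _ =>
      mul_le_mul_of_nonneg_left (theta_castSucc_le_max _) (hD.w_nonneg l)) hD.lam₂_nonneg
  simp only [F, Theta]
  linarith

/-- Each piece is at most `|t|/ν`, so the subtracted part never exceeds the penalty.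
Level-boundedness of `f` thus passes to `F(·;ν)`. -/
theorem f_le_F (x : Vec n) : D.f x ≤ D.F D.ν x := by
  rw [F_eq, fbar, penalty, Theta, div_mul_eq_mul_div, div_mul_eq_mul_div, mul_div_assoc,
    mul_div_assoc, Finset.sum_div, Finset.sum_div]
  have h1 : D.lam₁ * ∑ j, theta D.ν (D.idxI x j) (x j) ≤ D.lam₁ * ∑ j, |x j| / D.ν :=
    mul_le_mul_of_nonneg_left (Finset.sum_le_sum fun j _ => theta_le_abs_div hD.ν_pos _ _)
      hD.lam₁_pos.le
  have h2 : D.lam₂ * ∑ l, D.w l * theta D.ν (D.idxJ x l).castSucc (D.groupNorm l x) ≤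
      D.lam₂ * ∑ l, D.w l * D.groupNorm l x / D.ν := by
    refine mul_le_mul_of_nonneg_left (Finset.sum_le_sum fun l _ => ?_) hD.lam₂_nonneg
    rw [mul_div_assoc]
    refine mul_le_mul_of_nonneg_left ?_ (hD.w_nonneg l)
    have := theta_le_abs_div hD.ν_pos (D.idxJ x l).castSucc (D.groupNorm l x)
    rwa [abs_of_nonneg (groupNorm_nonneg hD.p_eq l x)] at this
  linarith

theorem continuous_fn : Continuous D.fn := hD.convex_fn.locallyLipschitz.continuous

theorem continuous_fs : Continuous D.fs := hD.convex_fs.locallyLipschitz.continuous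

theorem continuous_f : Continuous D.f := hD.continuous_fn.add hD.continuous_fs

theorem convex_f : ConvexOn ℝ Set.univ D.f := hD.convex_fn.add hD.convex_fs

theorem continuous_gradient : Continuous (gradient D.fs) := by
  have : LipschitzWith ⟨Ls, hD.Ls_pos.le⟩ (gradient D.fs) := by
    refine LipschitzWith.of_dist_le_mul fun x y => ?_
    rw [dist_eq_norm, dist_eq_norm]
    exact hD.lip_grad x y
  exact this.continuous

theorem continuous_penalty (μ : ℝ) : Continuous (D.penalty μ) := by
  have := continuous_groupNorm hD.p_eq
  unfold penalty
  fun_prop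

theorem continuous_Theta (I : Fin n → Fin 3) (J : Fin L → Fin 2) (μ : ℝ) :
    Continuous (D.Theta I J μ) := by
  have h1 := continuous_groupNorm hD.p_eq
  have h2 := continuous_theta μ
  unfold Theta
  fun_prop

theorem continuous_F (μ : ℝ) : Continuous (D.F μ) := by
  have h1 := continuous_groupNorm hD.p_eq
  have h2 := continuous_theta μ
  have h3 := hD.continuous_penalty μ
  have h4 := hD.continuous_f
  unfold F fbar
  fun_prop

theorem mem_Ω_of_between {y z : Vec n} (hy : y ∈ D.Ω)
    (hz : ∀ j, (0 ≤ z j ∧ z j ≤ y j) ∨ (y j ≤ z j ∧ z j ≤ 0)) : z ∈ D.Ω := by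
  intro j
  obtain ⟨h1, h2⟩ := hy j
  rcases hz j with ⟨h3, h4⟩ | ⟨h3, h4⟩
  · exact ⟨(hD.lo_nonpos j).trans (by exact_mod_cast h3), le_trans (by exact_mod_cast h4) h2⟩
  · exact ⟨h1.trans (by exact_mod_cast h3), le_trans (by exact_mod_cast h4) (hD.up_nonneg j)⟩

/-- Convexity at `z` and the Lipschitz gradient give the quadratic bound with `Ls` in place of the
sharp `Ls/2`; this only enlarges the bound on `α`. -/
theorem fs_le (x z : Vec n) :
    D.fs z ≤ D.fs x + inner ℝ (gradient D.fs x) (z - x) + Ls * ‖z - x‖ ^ 2 := by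
  have h1 := gradient_mem_subdiff hD.convex_fs (hD.diff_fs z) x
  have h2 : inner ℝ (gradient D.fs z - gradient D.fs x) (z - x) ≤ Ls * ‖z - x‖ ^ 2 := by
    refine (real_inner_le_norm _ _).trans ?_
    rw [pow_two, ← mul_assoc]
    exact mul_le_mul_of_nonneg_right (hD.lip_grad z x) (norm_nonneg _)
  have h3 : inner ℝ (gradient D.fs z) (x - z) = - inner ℝ (gradient D.fs z) (z - x) := by
    rw [← inner_neg_right, neg_sub]
  rw [inner_sub_left] at h2
  linarith

/-- The restriction to `k ≥ K` is essential: `I^k`, `J^k` are defined with `ν`, so the model touches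
`F` at `x k` once `μ_k = ν`. -/
theorem F_le_of_isTrial {P : Params} {x : ℕ → Vec n} {k : ℕ} (hk : P.K ≤ k) {α : ℝ} {z : Vec n}
    (hxk : x k ∈ D.Ω) (hz : D.IsTrial P x k α z) :
    D.F D.ν z ≤ D.F D.ν (x k) - (α / 2 - Ls) * ‖z - x k‖ ^ 2 := by
  have hμ : P.μ D.ν k = D.ν := by simp [Params.μ, not_lt.mpr hk]
  obtain ⟨ξ, hξ, -, hmin⟩ := hz
  rw [hμ] at hξ hmin
  have h1 := hmin hxk
  have h2 := hξ z
  have h3 := hD.fs_le (x k) z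
  have h4 := hD.F_le (D.idxI (x k)) (D.idxJ (x k)) D.ν z
  rw [F_eq (x k)]
  simp only [model, sub_self, norm_zero, inner_zero_right, fbar, fbarn, f, Set.mem_ofPred_eq]
    at h1 h4 ⊢
  linarith

theorem accept_of_isTrial {P : Params} {x : ℕ → Vec n} {k : ℕ} (hk : P.K ≤ k) {α : ℝ} {z : Vec n}
    (hxk : x k ∈ D.Ω) (hz : D.IsTrial P x k α z) (hα : 2 * Ls + P.c ≤ α) : D.Accept P x k z := by
  have hμ : P.μ D.ν k = D.ν := by simp [Params.μ, not_lt.mpr hk]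
  have h1 := hD.F_le_of_isTrial hk hxk hz
  have h2 := Finset.le_sup' (fun j => D.F D.ν (x j))
    (Finset.mem_Icc.mpr ⟨Nat.sub_le k P.N, le_rfl⟩)
  have h3 : P.c / 2 * ‖z - x k‖ ^ 2 ≤ (α / 2 - Ls) * ‖z - x k‖ ^ 2 :=
    mul_le_mul_of_nonneg_right (by linarith) (sq_nonneg _)
  unfold Accept
  rw [hμ]
  linarith

/-! ### The threshold property. -/

/-- The key property of the subproblems: a coordinate below the threshold `ν` becomes zero if the
step is short. -/
theorem exists_forall_next_eq_zero {A : ℝ} (hA : 0 ≤ A) :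
    ∃ δ > 0, ∀ x ∈ D.Ω, ∀ y, ∀ ξ ∈ subdiff (D.Theta (D.idxI x) (D.idxJ x) D.ν) x,
      ∀ α, 0 ≤ α → α ≤ A →
      IsArgmin (fun y' => D.model (D.idxI x) (D.idxJ x) ξ D.ν x x y' + α / 2 * ‖y' - x‖ ^ 2) D.Ω y →
      ‖y - x‖ ≤ δ → ∀ j, |x j| < D.ν → y j = 0 := by
  have hν := hD.ν_pos
  have hp := hD.p_eq
  set γ := D.lam₁ / D.ν - Lf with hγ
  have hγ0 : 0 < γ := by
    have : Lf < D.lam₁ / D.ν := by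
      rw [lt_div_iff₀ hν, mul_comm]; exact hD.ν_lt
    linarith
  have hW : 0 ≤ ∑ l, D.w l := Finset.sum_nonneg fun l _ => hD.w_nonneg l
  -- `C * δ` collects all errors per unit length: the group terms, the proximal term, and a spare
  -- `1` that keeps `C` positive. `δ` makes it at most half of the gap `γ`.
  set C := D.lam₂ * (∑ l, D.w l) * 12 / D.ν ^ 2 + 2 * A + 1 with hC
  have hC0 : 0 < C := by
    have := hD.lam₂_nonneg
    positivity
  have hδ0 : 0 < min (D.ν / 2) (γ / (2 * C)) := by positivity
  refine ⟨min (D.ν / 2) (γ / (2 * C)), hδ0, ?_⟩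
  set δ := min (D.ν / 2) (γ / (2 * C)) with hδ
  have hδν : δ ≤ D.ν / 2 := min_le_left _ _
  have hCδ : C * δ ≤ γ / 2 := by
    have : δ ≤ γ / (2 * C) := min_le_right _ _
    rw [le_div_iff₀ (by positivity)] at this
    linarith
  intro x hx y ξ hξ α hα0 hαA hy hyx j hj
  by_contra hyj
  obtain ⟨σ, hσ, hσy⟩ : ∃ σ : ℝ, |σ| = 1 ∧ y j = σ * |y j| := by
    rcases lt_or_gt_of_ne hyj with h | h
    · exact ⟨-1, by simp, by rw [abs_of_neg h]; ring⟩
    · exact ⟨1, by simp, by rw [abs_of_pos h]; ring⟩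
  -- The competitor is `y - s • e`, with `e` the signed unit vector of coordinate `j`; `s ≤ |y j|`
  -- prevents overshooting zero, so it stays in the box.
  set s := min δ |y j| with hs
  have hs0 : 0 < s := lt_min hδ0 (abs_pos.mpr hyj)
  have hsδ : s ≤ δ := min_le_left _ _
  have hsy : s ≤ |y j| := min_le_right _ _
  set e : Vec n := EuclideanSpace.single j σ with he
  have hen : ‖e‖ = 1 := by rw [he, PiLp.norm_single, Real.norm_eq_abs, hσ]
  have hej : e j = σ := by simp [he]
  have hei : ∀ i, i ≠ j → e i = 0 := fun i hi => by simp [he, hi]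
  have hinner : ∀ v : Vec n, inner ℝ v e = σ * v j := by
    intro v
    rw [he, EuclideanSpace.inner_single_right]
    simp
  have hye : ∀ i, |y i - s * e i| = |y i| - s * |e i| := by
    intro i
    by_cases hi : i = j
    · subst hi
      rw [hej, hσ, mul_one]
      have : y i - s * σ = σ * (|y i| - s) := by rw [mul_sub, ← hσy]; ring
      rw [this, abs_mul, hσ, one_mul, abs_of_nonneg (by linarith)]
    · simp [hei i hi]
  have hyΩ : y - s • e ∈ D.Ω := by
    refine hD.mem_Ω_of_between hy.1 fun i => ?_
    simp only [PiLp.sub_apply, PiLp.smul_apply, smul_eq_mul]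
    by_cases hi : i = j
    · subst hi
      rw [hej]
      rcases abs_eq (zero_le_one' ℝ) |>.mp hσ with h | h <;> rw [h] at hσy ⊢
      · left; constructor <;> linarith
      · right; constructor <;> linarith
    · simp only [hei i hi, mul_zero, sub_zero]
      rcases le_total 0 (y i) with h | h
      · exact Or.inl ⟨h, le_rfl⟩
      · exact Or.inr ⟨le_rfl, h⟩
  have h1 := hy.2 hyΩ
  simp only [model, Set.mem_ofPred_eq, fbarn] at h1
  have hsub : y - s • e - x = (y - x) - s • e := by abel
  rw [hsub, inner_sub_right _ (y - x) (s • e), inner_sub_right _ (y - x) (s • e),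
    real_inner_smul_right, real_inner_smul_right] at h1
  -- The subgradient is taken at the competitor, since its inequality at `y` bounds the increase of
  -- `fn` from above.
  obtain ⟨ζ, hζ⟩ := subdiff_nonempty hD.convex_fn (y - s • e)
  have h2 := hζ y
  rw [sub_sub_cancel, real_inner_smul_right] at h2
  have h3 : -Lf ≤ inner ℝ (ζ + gradient D.fs x) e := by
    have h4 := hD.Lf_split _ hyΩ x hx _ (Set.add_mem_add hζ
      (gradient_mem_subdiff hD.convex_fs (hD.diff_fs x))) j
    rw [hinner]
    have h5 := neg_abs_le (σ * (ζ + gradient D.fs x) j)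
    rw [abs_mul, hσ, one_mul] at h5
    linarith
  rw [inner_add_left] at h3
  have h3s := mul_le_mul_of_nonneg_left h3 hs0.le
  -- Testing here bounds `s * ⟪ξ, e⟫` by an increment of `Θ`, which has no ℓ₁ contribution:
  -- coordinate `j` has the zero piece and the others do not move.
  have h4 := hξ (x + s • e)
  rw [add_sub_cancel_left, real_inner_smul_right] at h4
  have h5 : ‖y - x - s • e‖ ^ 2 ≤ ‖y - x‖ ^ 2 + 3 * (s * δ) := by
    rw [norm_sub_sq_real, norm_smul, hen, Real.norm_of_nonneg hs0.le, real_inner_smul_right]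
    have h6 := neg_le_of_abs_le (abs_real_inner_le_norm (y - x) e)
    rw [hen, mul_one] at h6
    nlinarith
  have h5α : α / 2 * ‖y - x - s • e‖ ^ 2 - α / 2 * ‖y - x‖ ^ 2 ≤ 2 * A * (s * δ) := by
    have h6 : 0 ≤ s * δ := by positivity
    nlinarith
  have h6 : D.penalty D.ν (y - s • e) - D.penalty D.ν y
      + (D.Theta (D.idxI x) (D.idxJ x) D.ν (x + s • e) - D.Theta (D.idxI x) (D.idxJ x) D.ν x)
      ≤ -(s * (D.lam₁ / D.ν)) + s * (D.lam₂ * (∑ l, D.w l) * 12 / D.ν ^ 2 * δ) := by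
    have ha : ∑ i, |(y - s • e) i| = ∑ i, |y i| - s := by
      have : ∑ i, |e i| = 1 := by
        rw [Finset.sum_eq_single j (fun i _ hi => by simp [hei i hi]) (by simp), hej, hσ]
      simp only [PiLp.sub_apply, PiLp.smul_apply, smul_eq_mul, hye]
      rw [Finset.sum_sub_distrib, ← Finset.mul_sum, this, mul_one]
    have hb : ∑ i, theta D.ν (D.idxI x i) ((x + s • e) i) = ∑ i, theta D.ν (D.idxI x i) (x i) := by
      refine Finset.sum_congr rfl fun i _ => ?_
      by_cases hi : i = j
      · subst hi
        rw [idxI_of_abs_lt hν hj, theta_zero, theta_zero]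
      · simp [hei i hi]
    have hc : ∀ l, (D.groupNorm l (y - s • e) - D.groupNorm l y) / D.ν
        + (theta D.ν (D.idxJ x l).castSucc (D.groupNorm l (x + s • e))
          - theta D.ν (D.idxJ x l).castSucc (D.groupNorm l x)) ≤ s * (12 / D.ν ^ 2 * δ) := by
      intro l
      rcases lt_or_ge (D.groupNorm l x) D.ν with h | h
      · rw [idxJ_of_lt hν h]
        simp only [Fin.castSucc_zero, theta_zero, sub_self, add_zero]
        have h7 : D.groupNorm l (y - s • e) ≤ D.groupNorm l y := by
          refine groupNorm_le_groupNorm hp fun i _ => ?_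
          simp only [PiLp.sub_apply, PiLp.smul_apply, smul_eq_mul, hye]
          have : 0 ≤ s * |e i| := by positivity
          linarith
        have h8 : (D.groupNorm l (y - s • e) - D.groupNorm l y) / D.ν ≤ 0 :=
          div_nonpos_of_nonpos_of_nonneg (by linarith) hν.le
        have h9 : 0 ≤ s * (12 / D.ν ^ 2 * δ) := by positivity
        linarith
      · rw [idxJ_of_le hν h]
        have h7 := groupNorm_step_le hp hν h hyx hs0.le hsδ hδν hen.le hye
        have h8 := div_le_div_of_nonneg_right h7 hν.le
        have h9 : s * (12 * δ / D.ν) / D.ν = s * (12 / D.ν ^ 2 * δ) := by field_simp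
        rw [h9] at h8
        have h10 : (1 : Fin 2).castSucc = (1 : Fin 3) := rfl
        rw [h10, theta_one, theta_one]
        refine le_trans (le_of_eq ?_) h8
        ring
    have hd := Finset.sum_le_sum fun l (_ : l ∈ Finset.univ) =>
      mul_le_mul_of_nonneg_left (hc l) (hD.w_nonneg l)
    have hd' := mul_le_mul_of_nonneg_left hd hD.lam₂_nonneg
    simp only [penalty, Theta, ha, hb]
    refine le_trans (le_of_eq ?_) (add_le_add (le_refl (-(s * (D.lam₁ / D.ν)))) (hd'.trans
      (le_of_eq ?_)))
    · simp only [Finset.mul_sum, mul_add, mul_sub, sub_div, Finset.sum_add_distrib,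
        Finset.sum_sub_distrib]
      have : ∀ g : Fin L → ℝ, ∑ l, D.lam₂ / D.ν * (D.w l * g l)
          = ∑ l, D.lam₂ * (D.w l * (g l / D.ν)) :=
        fun g => Finset.sum_congr rfl fun l _ => by ring
      rw [this, this]
      ring
    · rw [← Finset.sum_mul]
      ring
  have h7 : 0 ≤ s * (C * δ - δ - γ) := by
    have : s * (C * δ - δ - γ) = s * (D.lam₂ * (∑ l, D.w l) * 12 / D.ν ^ 2 * δ) + 2 * A * (s * δ)
        - s * (D.lam₁ / D.ν) + s * Lf := by
      rw [hC, hγ]; ring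
    rw [this]
    linarith
  have h8 := nonneg_of_mul_nonneg_right h7 hs0
  linarith

end Assumptions

end Data


/-! ### Limits of the subproblems at a point without small nonzero entries. -/

theorem theta_affine (μ : ℝ) (i : Fin 3) {s t : ℝ} (r q : ℝ) (hst : s + t = 1) :
    theta μ i (s * r + t * q) = s * theta μ i r + t * theta μ i q := by
  obtain rfl : t = 1 - s := by linarith
  fin_cases i <;> simp [theta] <;> ring

theorem theta_second_difference (μ : ℝ) (i : Fin 3) (r q : ℝ) :
    theta μ i (r + q) + theta μ i (r - q) = 2 * theta μ i r := by
  fin_cases i <;> simp [theta] <;> ring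

theorem gradient_theta_mem_subdiff {n : ℕ} (μ : ℝ) (i : Fin 3) (j : Fin n) (x : Vec n) :
    gradient (fun z : Vec n => theta μ i (z j)) x ∈ subdiff (fun z : Vec n => theta μ i (z j)) x := by
  refine gradient_mem_subdiff ⟨convex_univ, fun y _ z _ s t _ _ hst => le_of_eq ?_⟩ ?_
  · exact theta_affine μ i (y j) (z j) hst
  · fin_cases i <;> simp only [Fin.zero_eta, Fin.mk_one, Fin.reduceFinMk, theta_zero, theta_one,
      theta_two] <;> fun_prop

/-- The subspace of the vectors supported in the support of `a`. -/
def supportedOn {n : ℕ} (a : Vec n) : Set (Vec n) := {y | ∀ j, a j = 0 → y j = 0}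

theorem convex_supportedOn {n : ℕ} (a : Vec n) : Convex ℝ (supportedOn a) := by
  intro y hy z hz s t _ _ _ j hj
  simp [hy j hj, hz j hj]

namespace Data

variable {n L : ℕ} {D : Data n L}

theorem penalty_sub_Theta (I : Fin n → Fin 3) (J : Fin L → Fin 2) (μ : ℝ) (y : Vec n) :
    D.penalty μ y - D.Theta I J μ y = D.lam₁ * ∑ j, (|y j| / μ - theta μ (I j) (y j))
      + D.lam₂ * ∑ l, D.w l * (D.groupNorm l y / μ - theta μ (J l).castSucc (D.groupNorm l y)) := by
  simp only [penalty, Theta, mul_sub, Finset.sum_sub_distrib, Finset.mul_sum]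
  have h1 : ∀ r q s : ℝ, r / μ * (q * s) = r * (q * (s / μ)) := fun r q s => by ring
  have h2 : ∀ r q : ℝ, r / μ * q = r * (q / μ) := fun r q => by ring
  simp only [h1]
  simp only [h2]
  ring

namespace Assumptions

variable {Lf Ls : ℝ} (hD : D.Assumptions Lf Ls) {a : Vec n} (hbig : ∀ j, a j ≠ 0 → D.ν ≤ |a j|)
include hD

theorem mem_subdiff_Theta {μ : ℝ} {I : Fin n → Fin 3} {J : Fin L → Fin 2} {x ξ : Vec n}
    (hξ : ξ ∈ {D.lam₁ • ∑ j, gradient (fun z : Vec n => theta μ (I j) (z j)) x}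
        + D.lam₂ • ∑ l, D.w l •
            subdiff (fun z => theta μ (J l).castSucc (D.groupNorm l z)) x) :
    ξ ∈ subdiff (D.Theta I J μ) x := by
  obtain ⟨_, rfl, _, ⟨v, hv, rfl⟩, rfl⟩ := hξ
  obtain ⟨g, hg, rfl⟩ := Set.mem_fintype_sum _ _ |>.mp hv
  choose q hq hqg using fun l => Set.mem_smul_set.mp (hg l)
  intro y
  have h1 := Finset.sum_le_sum fun j (_ : j ∈ Finset.univ) =>
    gradient_theta_mem_subdiff μ (I j) j x y
  have h2 := Finset.sum_le_sum fun l (_ : l ∈ Finset.univ) =>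
    mul_le_mul_of_nonneg_left (hq l y) (hD.w_nonneg l)
  have h3 := mul_le_mul_of_nonneg_left h1 hD.lam₁_pos.le
  have h4 := mul_le_mul_of_nonneg_left h2 hD.lam₂_nonneg
  simp only [← hqg, Theta, inner_add_left, real_inner_smul_left, sum_inner]
  simp only [mul_add, Finset.sum_add_distrib] at h3 h4
  linarith

theorem idxI_eq_zero {j : Fin n} (hj : a j = 0) : D.idxI a j = 0 :=
  idxI_of_abs_lt hD.ν_pos (by simpa [hj] using hD.ν_pos)

include hbig

theorem idxI_ne_zero {j : Fin n} (hj : a j ≠ 0) :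
    (D.ν ≤ a j ∧ D.idxI a j = 1) ∨ (a j ≤ -D.ν ∧ D.idxI a j = 2) := by
  rcases le_abs.mp (hbig j hj) with h | h
  · exact Or.inl ⟨h, idxI_of_le hD.ν_pos h⟩
  · have h' : a j ≤ -D.ν := by linarith
    exact Or.inr ⟨h', idxI_of_le_neg hD.ν_pos h'⟩

/-- A group norm below `ν` bounds every entry of the group below `ν`, and such entries vanish by
`hbig`. -/
theorem idxJ_cases (l : Fin L) : ((∀ j ∈ D.G l, a j = 0) ∧ D.idxJ a l = 0) ∨ D.idxJ a l = 1 := by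
  rcases lt_or_ge (D.groupNorm l a) D.ν with h | h
  · refine Or.inl ⟨fun j hj => ?_, idxJ_of_lt hD.ν_pos h⟩
    by_contra h1
    have h2 := hbig j h1
    have h3 := abs_le_groupNorm hD.p_eq a hj
    linarith
  · exact Or.inr (idxJ_of_le hD.ν_pos h)

/-- The difference of the penalty and its concave correction has a sharp minimum at `a`. -/
theorem penalty_sub_Theta_ge (y : Vec n) :
    D.penalty D.ν a - D.Theta (D.idxI a) (D.idxJ a) D.ν a
      + D.lam₁ * ∑ j, (if a j = 0 then |y j| / D.ν else 0)
      ≤ D.penalty D.ν y - D.Theta (D.idxI a) (D.idxJ a) D.ν y := by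
  have hν := hD.ν_pos
  rw [penalty_sub_Theta, penalty_sub_Theta, add_right_comm, ← mul_add, ← Finset.sum_add_distrib]
  refine add_le_add (mul_le_mul_of_nonneg_left (Finset.sum_le_sum fun j _ => ?_) hD.lam₁_pos.le)
    (mul_le_mul_of_nonneg_left (Finset.sum_le_sum fun l _ =>
      mul_le_mul_of_nonneg_left ?_ (hD.w_nonneg l)) hD.lam₂_nonneg)
  · by_cases hj : a j = 0
    · simp [hD.idxI_eq_zero hj, hj]
    · have h1 : y j / D.ν ≤ |y j| / D.ν := by gcongr; exact le_abs_self _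
      have h2 : -y j / D.ν ≤ |y j| / D.ν := by gcongr; exact neg_le_abs _
      rw [if_neg hj]
      rcases hD.idxI_ne_zero hbig hj with ⟨h, h3⟩ | ⟨h, h3⟩
      · rw [h3, theta_one, theta_one, abs_of_nonneg (by linarith : 0 ≤ a j)]
        linarith
      · rw [h3, theta_two, theta_two, abs_of_nonpos (by linarith : a j ≤ 0)]
        linarith
  · rcases hD.idxJ_cases hbig l with ⟨h1, h2⟩ | h2
    · rw [h2, groupNorm_eq_zero hD.p_eq h1]
      simpa using div_nonneg (groupNorm_nonneg hD.p_eq l y) hν.le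
    · have h3 : (1 : Fin 2).castSucc = (1 : Fin 3) := rfl
      rw [h2, h3, theta_one, theta_one]
      linarith

/-- On the support, with the signs of `a`, each active piece cancels its penalty up to a constant;
off the support everything is zero. -/
theorem penalty_sub_Theta_le {y : Vec n} (hy : y ∈ supportedOn a) (hsign : ∀ j, 0 ≤ a j * y j) :
    D.penalty D.ν y - D.Theta (D.idxI a) (D.idxJ a) D.ν y
      ≤ D.penalty D.ν a - D.Theta (D.idxI a) (D.idxJ a) D.ν a := by
  have hν := hD.ν_pos
  rw [penalty_sub_Theta, penalty_sub_Theta]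
  refine add_le_add (mul_le_mul_of_nonneg_left (Finset.sum_le_sum fun j _ => ?_) hD.lam₁_pos.le)
    (mul_le_mul_of_nonneg_left (Finset.sum_le_sum fun l _ =>
      mul_le_mul_of_nonneg_left ?_ (hD.w_nonneg l)) hD.lam₂_nonneg)
  · by_cases hj : a j = 0
    · simp [hy j hj, hj]
    · rcases hD.idxI_ne_zero hbig hj with ⟨h, h3⟩ | ⟨h, h3⟩
      · have h4 : 0 ≤ y j := nonneg_of_mul_nonneg_right (hsign j) (by linarith)
        rw [h3, theta_one, theta_one, abs_of_nonneg (by linarith : 0 ≤ a j), abs_of_nonneg h4]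
        linarith
      · have h4 : y j ≤ 0 := by nlinarith [hsign j]
        rw [h3, theta_two, theta_two, abs_of_nonpos (by linarith : a j ≤ 0), abs_of_nonpos h4]
        linarith
  · rcases hD.idxJ_cases hbig l with ⟨h1, h2⟩ | h2
    · rw [groupNorm_eq_zero hD.p_eq h1, groupNorm_eq_zero hD.p_eq fun j hj => hy j (h1 j hj)]
    · have h3 : (1 : Fin 2).castSucc = (1 : Fin 3) := rfl
      rw [h2, h3, theta_one, theta_one]
      linarith

omit hbig in
-- A substitute for differentiability of `Θ` along `d`: the pieces in the coordinates are affine,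
-- and the group norms have quadratic second differences. It converts `Θ (a - t • d)` into `-Θ (a +
-- t • d)` up to `O(t²)`.
theorem Theta_second_difference (I : Fin n → Fin 3) (J : Fin L → Fin 2) {d : Vec n}
    (hd : d ∈ supportedOn a) :
    ∃ C, ∀ᶠ t : ℝ in 𝓝[>] 0,
      D.Theta I J D.ν (a + t • d) + D.Theta I J D.ν (a - t • d) - 2 * D.Theta I J D.ν a
        ≤ C * t ^ 2 := by
  have hν := hD.ν_pos
  choose C hC0 hC using fun l => groupNorm_second_difference (D := D) hD.p_eq l hd
  refine ⟨D.lam₂ * ∑ l, D.w l * (C l / D.ν), ?_⟩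
  filter_upwards [eventually_all.mpr hC] with t ht
  have h1 : ∑ j, theta D.ν (I j) ((a + t • d) j) + ∑ j, theta D.ν (I j) ((a - t • d) j)
      = 2 * ∑ j, theta D.ν (I j) (a j) := by
    rw [← Finset.sum_add_distrib, Finset.mul_sum]
    exact Finset.sum_congr rfl fun j _ => theta_second_difference _ _ _ _
  have h2 : ∀ l, theta D.ν (J l).castSucc (D.groupNorm l (a + t • d))
      + theta D.ν (J l).castSucc (D.groupNorm l (a - t • d))
      - 2 * theta D.ν (J l).castSucc (D.groupNorm l a) ≤ C l / D.ν * t ^ 2 := by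
    intro l
    have h3 : (J l).castSucc = 0 ∨ (J l).castSucc = 1 := by
      generalize J l = i
      fin_cases i <;> simp
    rcases h3 with h3 | h3 <;> rw [h3]
    · have := hC0 l
      simp only [theta_zero]
      have : 0 ≤ C l / D.ν * t ^ 2 := by positivity
      linarith
    · have h4 := div_le_div_of_nonneg_right (ht l) hν.le
      simp only [theta_one]
      refine le_trans (le_of_eq ?_) (h4.trans (le_of_eq ?_)) <;> ring
  have h3 := Finset.sum_le_sum fun l (_ : l ∈ Finset.univ) =>
    mul_le_mul_of_nonneg_left (h2 l) (hD.w_nonneg l)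
  have h4 := mul_le_mul_of_nonneg_left h3 hD.lam₂_nonneg
  have h5 : D.lam₂ * ∑ l, D.w l * (C l / D.ν * t ^ 2)
      = D.lam₂ * ∑ l, D.w l * (C l / D.ν) * t ^ 2 := by
    congr 1
    exact Finset.sum_congr rfl fun l _ => by ring
  rw [h5, ← Finset.sum_mul, ← mul_assoc] at h4
  refine le_trans (le_of_eq ?_) h4
  have h6 : ∀ r q s : ℝ, r * (2 * q - s) = r * (2 * q) - r * s := fun r q s => mul_sub _ _ _
  simp only [Theta, mul_sub, mul_add, Finset.sum_sub_distrib, Finset.sum_add_distrib]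
  have h7 : ∑ l, D.w l * (2 * theta D.ν (J l).castSucc (D.groupNorm l a))
      = 2 * ∑ l, D.w l * theta D.ν (J l).castSucc (D.groupNorm l a) := by
    rw [Finset.mul_sum]
    exact Finset.sum_congr rfl fun l _ => by ring
  rw [h7]
  linear_combination D.lam₁ * h1

/-- A limit of solutions of the subproblems minimizes the loss over the feasible points with at
least the same zero entries. -/
theorem isArgmin_f_of_tendsto {ι : Type*} {F : Filter ι} [F.NeBot] {u v ξ : ι → Vec n} {α : ι → ℝ}
    {A : ℝ} (haΩ : a ∈ D.Ω) (hu : Tendsto u F (𝓝 a)) (hv : Tendsto v F (𝓝 a))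
    (hα : ∀ᶠ i in F, α i ≤ A) (hα0 : ∀ᶠ i in F, 0 ≤ α i)
    (hξ : ∀ᶠ i in F, ξ i ∈ subdiff (D.Theta (D.idxI a) (D.idxJ a) D.ν) (u i))
    (hmin : ∀ᶠ i in F, IsArgmin (fun y => D.model (D.idxI a) (D.idxJ a) (ξ i) D.ν (u i) (u i) y
      + α i / 2 * ‖y - u i‖ ^ 2) D.Ω (v i)) :
    IsArgmin D.f (D.Ω ∩ supportedOn a) a := by
  set Θ := D.Theta (D.idxI a) (D.idxJ a) D.ν with hΘ
  have hΘc : Continuous Θ := hD.continuous_Theta _ _ _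
  have hlim : ∀ y ∈ D.Ω, D.fn a + D.penalty D.ν a ≤ D.fn y + D.penalty D.ν y
      + inner ℝ (gradient D.fs a) (y - a) + A / 2 * ‖y - a‖ ^ 2 + Θ (a + a - y) - Θ a := by
    intro y hy
    have hgc := hD.continuous_gradient
    have hfc := hD.continuous_fn
    have hpc := hD.continuous_penalty D.ν
    have hgu : Tendsto (fun i => gradient D.fs (u i)) F (𝓝 (gradient D.fs a)) :=
      (hgc.tendsto a).comp hu
    have hl : Tendsto (fun i => D.fn (v i) + D.penalty D.ν (v i)
        + inner ℝ (gradient D.fs (u i)) (v i - u i)) F (𝓝 (D.fn a + D.penalty D.ν a)) := by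
      have h1 : Tendsto (fun i => inner ℝ (gradient D.fs (u i)) (v i - u i)) F (𝓝 0) := by
        simpa using hgu.inner (𝕜 := ℝ) (hv.sub hu)
      simpa using (((hfc.tendsto a).comp hv).add ((hpc.tendsto a).comp hv)).add h1
    have hr : Tendsto (fun i => D.fn y + D.penalty D.ν y + inner ℝ (gradient D.fs (u i)) (y - u i)
        + A / 2 * ‖y - u i‖ ^ 2 + Θ (u i + v i - y) - Θ (u i)) F
        (𝓝 (D.fn y + D.penalty D.ν y + inner ℝ (gradient D.fs a) (y - a) + A / 2 * ‖y - a‖ ^ 2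
          + Θ (a + a - y) - Θ a)) := by
      have hyu : Tendsto (fun i => y - u i) F (𝓝 (y - a)) := tendsto_const_nhds.sub hu
      have h1 := hgu.inner (𝕜 := ℝ) hyu
      have h2 : Tendsto (fun i => A / 2 * ‖y - u i‖ ^ 2) F (𝓝 (A / 2 * ‖y - a‖ ^ 2)) :=
        (hyu.norm.pow 2).const_mul _
      have h3 : Tendsto (fun i => Θ (u i + v i - y)) F (𝓝 (Θ (a + a - y))) :=
        (hΘc.tendsto _).comp ((hu.add hv).sub tendsto_const_nhds)
      exact (((h1.const_add _).add h2).add h3).sub ((hΘc.tendsto a).comp hu)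
    refine le_of_tendsto_of_tendsto hl hr ?_
    filter_upwards [hα, hα0, hξ, hmin] with i h1 h0 h2 h3
    have h4 := h3.2 hy
    -- The reflected test point eliminates `ξ i`: the subgradient inequality bounds `⟪ξ, v - y⟫` by
    -- a difference of values of `Θ`, so no limit of the `ξ i` is needed.
    have h5 := h2 (u i + v i - y)
    simp only [model, fbarn, Set.mem_ofPred_eq] at h4
    have h6 : inner ℝ (ξ i) (u i + v i - y - u i) =
        inner ℝ (ξ i) (v i - u i) - inner ℝ (ξ i) (y - u i) := by
      rw [← inner_sub_right]; congr 1; abel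
    rw [h6] at h5
    have h7 : α i / 2 * ‖y - u i‖ ^ 2 ≤ A / 2 * ‖y - u i‖ ^ 2 := by gcongr
    have h8 : 0 ≤ α i / 2 * ‖v i - u i‖ ^ 2 := by positivity
    linarith
  refine ⟨⟨haΩ, fun j hj => hj⟩, fun y hy => ?_⟩
  obtain ⟨hyΩ, hyS⟩ := hy
  set d := y - a with hd
  have hdS : d ∈ supportedOn a := fun j hj => by simp [hd, hj, hyS j hj]
  obtain ⟨C, hC⟩ := hD.Theta_second_difference (D.idxI a) (D.idxJ a) hdS
  have hsign : ∀ᶠ t : ℝ in 𝓝[>] 0, ∀ j, 0 ≤ a j * (a + t • d) j := by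
    refine eventually_all.mpr fun j => ?_
    by_cases hj : a j = 0
    · exact Eventually.of_forall fun t => by simp [hj]
    · refine nhdsWithin_le_nhds ?_
      have hc : Continuous fun t : ℝ => a j * (a + t • d) j := by
        simp only [PiLp.add_apply, PiLp.smul_apply]
        fun_prop
      have h1 : Tendsto (fun t : ℝ => a j * (a + t • d) j) (𝓝 0) (𝓝 (a j * a j)) := by
        simpa using hc.tendsto 0
      exact h1.eventually (le_mem_nhds (mul_self_pos.mpr hj))
  have hle1 : ∀ᶠ t : ℝ in 𝓝[>] 0, t ≤ 1 := nhdsWithin_le_nhds (ge_mem_nhds one_pos)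
  have hpos : ∀ᶠ t : ℝ in 𝓝[>] 0, 0 < t := eventually_mem_nhdsWithin
  set B := C + A / 2 * ‖d‖ ^ 2 with hB
  have hmain : ∀ᶠ t : ℝ in 𝓝[>] 0, 0 ≤ (D.f y - D.f a) + B * t := by
    filter_upwards [hC, hsign, hle1, hpos] with t h1 h2 h3 h4
    have hcomb : a + t • d = (1 - t) • a + t • y := by rw [hd]; module
    have hmem : a + t • d ∈ D.Ω := by
      rw [hcomb]
      exact convex_Ω haΩ hyΩ (by linarith) h4.le (by ring)
    have hsupp : a + t • d ∈ supportedOn a := fun j hj => by simp [hj, hdS j hj]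
    have h5 := hlim _ hmem
    have h6 := hD.penalty_sub_Theta_le hbig hsupp h2
    have h7 := hD.convex_fn.2 (Set.mem_univ a) (Set.mem_univ y) (by linarith : 0 ≤ 1 - t) h4.le
      (by ring)
    rw [← hcomb, smul_eq_mul, smul_eq_mul] at h7
    have h8 := gradient_mem_subdiff hD.convex_fs (hD.diff_fs a) y
    have h9 := mul_le_mul_of_nonneg_left h8 h4.le
    have h10 : a + a - (a + t • d) = a - t • d := by abel
    rw [h10, add_sub_cancel_left, real_inner_smul_right, norm_smul, Real.norm_of_nonneg h4.le,
      mul_pow] at h5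
    rw [← hd] at h9
    -- Along `a + t • d` the increase of the penalty is at most that of `Θ`, and the
    -- second-difference bound cancels the latter against `Θ (a - t • d)`. Only the loss remains at
    -- first order in `t`.
    have h11 : 0 ≤ t * ((D.f y - D.f a) + B * t) := by
      simp only [f, hB]
      linarith
    exact nonneg_of_mul_nonneg_right h11 h4
  have hfin : Tendsto (fun t : ℝ => (D.f y - D.f a) + B * t) (𝓝[>] 0) (𝓝 (D.f y - D.f a)) := by
    have hc : Continuous fun t : ℝ => (D.f y - D.f a) + B * t := by fun_prop
    have := hc.tendsto 0
    rw [mul_zero, add_zero] at this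
    exact this.mono_left nhdsWithin_le_nhds
  have := ge_of_tendsto hfin hmain
  simp only [Set.mem_ofPred_eq]
  linarith

/-! ### From restricted minimality to stationarity and local minimality. -/

theorem isSwdStationary_of_isArgmin_f (ha : IsArgmin D.f (D.Ω ∩ supportedOn a) a) :
    D.IsSwdStationary a := by
  have hν := hD.ν_pos
  obtain ⟨η, hη, hηN⟩ := ha.exists_subdiff_neg_mem_normalCone hD.convex_f
    (convex_Ω.inter (convex_supportedOn a))
  have hηL : ∀ j, |η j| ≤ D.lam₁ / D.ν := fun j => by
    rw [le_div_iff₀ hν]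
    have := hD.Lf_f a ha.1.1 η hη j
    have := mul_le_mul_of_nonneg_right this hν.le
    linarith [hD.ν_lt]
  let r : Vec n → Vec n := fun y => WithLp.toLp 2 fun j => if a j = 0 then 0 else y j
  have hr : ∀ y, inner ℝ (r η) (y - a) = inner ℝ η (r y - a) := by
    intro y
    simp only [PiLp.inner_apply]
    refine Finset.sum_congr rfl fun j _ => ?_
    by_cases hj : a j = 0 <;> simp [r, hj]
  refine ⟨ha.1.1, fun ξ hξ => ?_⟩
  have hξΘ := hD.mem_subdiff_Theta hξ
  -- Every `ξ` on the left splits as `(ξ + r η) + (-r η)`. Deleting the entries of `η` at the zeros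
  -- of `a` makes `-r η` normal to the whole box; the deleted entries, at most `λ₁/ν`, are paid for
  -- by the sharp minimum in `penalty_sub_Theta_ge`.
  refine ⟨ξ + r η, fun y => ?_, -r η, fun y hy => ?_, by simp⟩
  · have h1 := hξΘ y
    have h2 := hη y
    have h3 := hD.penalty_sub_Theta_ge hbig y
    have h4 : inner ℝ η (y - a) = inner ℝ (r η) (y - a)
        + ∑ j, (if a j = 0 then η j * y j else 0) := by
      simp only [PiLp.inner_apply, ← Finset.sum_add_distrib]
      refine Finset.sum_congr rfl fun j _ => ?_
      by_cases hj : a j = 0 <;> simp [r, hj, mul_comm]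
    have h5 : 0 ≤ ∑ j, (if a j = 0 then η j * y j else 0)
        + D.lam₁ * ∑ j, (if a j = 0 then |y j| / D.ν else 0) := by
      rw [Finset.mul_sum, ← Finset.sum_add_distrib]
      refine Finset.sum_nonneg fun j _ => ?_
      by_cases hj : a j = 0
      · simp only [hj, if_true]
        have h6 := neg_abs_le (η j * y j)
        rw [abs_mul] at h6
        have h7 := mul_le_mul_of_nonneg_right (hηL j) (abs_nonneg (y j))
        have h8 : D.lam₁ * (|y j| / D.ν) = D.lam₁ / D.ν * |y j| := by ring
        linarith
      · simp [hj]
    rw [inner_add_left]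
    simp only [fbar]
    linarith
  · rw [inner_neg_left, hr, ← inner_neg_left]
    refine hηN _ ⟨hD.mem_Ω_of_between hy fun j => ?_, fun j hj => by simp [r, hj]⟩
    by_cases hj : a j = 0
    · simp [r, hj, le_total]
    · simp [r, hj, le_total]

theorem isStrongLocalMin_of_isArgmin_f (ha : IsArgmin D.f (D.Ω ∩ supportedOn a) a) :
    D.IsStrongLocalMin a := by
  refine ⟨ha.1.1, ?_, hbig⟩
  have hl := hD.lam₁_pos
  have hf : ∀ᶠ y in 𝓝[D.Ω] a, D.f a - D.lam₁ < D.f y :=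
    nhdsWithin_le_nhds (hD.continuous_f.continuousAt.eventually (lt_mem_nhds (by linarith)))
  have hx : ∀ᶠ y : Vec n in 𝓝[D.Ω] a, ∀ j, a j ≠ 0 → y j ≠ 0 := by
    refine nhdsWithin_le_nhds (eventually_all.mpr fun j => ?_)
    by_cases hj : a j = 0
    · simp [hj]
    · have hc : Continuous fun y : Vec n => y j := by fun_prop
      filter_upwards [hc.continuousAt.eventually_ne hj] with y hy _ using hy
  have hg : ∀ᶠ y : Vec n in 𝓝[D.Ω] a, ∀ l, D.groupNorm l a ≠ 0 → D.groupNorm l y ≠ 0 := by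
    refine nhdsWithin_le_nhds (eventually_all.mpr fun l => ?_)
    by_cases hj : D.groupNorm l a = 0
    · simp [hj]
    · filter_upwards [(continuous_groupNorm hD.p_eq l).continuousAt.eventually_ne hj] with y hy _
        using hy
  have hind : ∀ r q : ℝ, (r ≠ 0 → q ≠ 0) → ind r ≤ ind q := by
    intro r q h
    unfold ind
    by_cases hr : r = 0
    · rw [if_pos hr]; split_ifs <;> norm_num
    · rw [if_neg hr, if_neg (h hr)]
  filter_upwards [hf, hx, hg, eventually_mem_nhdsWithin] with y h1 h2 h3 h4
  have h5 : D.lam₂ * ∑ l, D.w l * ind (D.groupNorm l a) ≤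
      D.lam₂ * ∑ l, D.w l * ind (D.groupNorm l y) :=
    mul_le_mul_of_nonneg_left (Finset.sum_le_sum fun l _ =>
      mul_le_mul_of_nonneg_left (hind _ _ (h3 l)) (hD.w_nonneg l)) hD.lam₂_nonneg
  simp only [F₀]
  by_cases hy : y ∈ supportedOn a
  · have h6 : D.f a ≤ D.f y := ha.2 ⟨h4, hy⟩
    have h7 : D.lam₁ * ∑ j, ind (a j) ≤ D.lam₁ * ∑ j, ind (y j) :=
      mul_le_mul_of_nonneg_left (Finset.sum_le_sum fun j _ => hind _ _ (h2 j)) hl.le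
    linarith
  -- A new nonzero entry costs a full `λ₁`, while `f` drops by less than `λ₁` near `a`; no other
  -- indicator decreases.
  · obtain ⟨j, hj, hyj⟩ : ∃ j, a j = 0 ∧ y j ≠ 0 := by
      by_contra! h
      exact hy h
    have h6 : ∑ j, ind (a j) + 1 ≤ ∑ j, ind (y j) := by
      have h7 : (1 : ℝ) = ∑ i, if i = j then 1 else 0 := by simp
      rw [h7, ← Finset.sum_add_distrib]
      refine Finset.sum_le_sum fun i _ => ?_
      by_cases hi : i = j
      · subst hi
        simp [ind, hj, hyj]
      · simpa [hi] using hind _ _ (h2 i)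
    have h7 := mul_le_mul_of_nonneg_left h6 hl.le
    linarith

end Assumptions

end Data


/-! ### Asymptotics of the iterates. -/

namespace Data

variable {n L : ℕ} {D : Data n L} {P : Params} {x : ℕ → Vec n}

theorem IsIterates.mem_Ω (hx : D.IsIterates P x) (k : ℕ) : x k ∈ D.Ω := by
  cases k with
  | zero => exact hx.1
  | succ k =>
    obtain ⟨αB, -, m, z, h1, -, -, h2⟩ := hx.2 k
    obtain ⟨ξ, -, h3⟩ := h1 m le_rfl
    rw [h2]
    exact h3.1

theorem IsIterates.F_succ_le (hx : D.IsIterates P x) {k : ℕ} (hk : P.K ≤ k) :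
    D.F D.ν (x (k + 1)) ≤ (Finset.Icc (k - P.N) k).sup'
      (Finset.nonempty_Icc.mpr (Nat.sub_le k P.N)) (fun j => D.F D.ν (x j))
      - P.c / 2 * ‖x (k + 1) - x k‖ ^ 2 := by
  have hμ : P.μ D.ν k = D.ν := by simp [Params.μ, not_lt.mpr hk]
  obtain ⟨αB, -, m, z, -, -, h3, h4⟩ := hx.2 k
  unfold Accept at h3
  rw [hμ] at h3
  rw [h4]
  exact h3

namespace Assumptions

variable {Lf Ls : ℝ} (hD : D.Assumptions Lf Ls) (hP : P.Valid D.ν Ls) (hx : D.IsIterates P x)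
include hD hP hx

/-- The accepted constants `α` are bounded once `μ` has reached its final value `ν`. -/
theorem exists_bounded_alpha : ∃ A, 0 ≤ A ∧ ∀ k ≥ P.K, ∃ ξ ∈
    subdiff (D.Theta (D.idxI (x k)) (D.idxJ (x k)) D.ν) (x k), ∃ α, 0 ≤ α ∧ α ≤ A ∧
      IsArgmin (fun y => D.model (D.idxI (x k)) (D.idxJ (x k)) ξ D.ν (x k) (x k) y
        + α / 2 * ‖y - x k‖ ^ 2) D.Ω (x (k + 1)) := by
  have hρ := hP.ρ_gt
  have hLs := hD.Ls_pos
  have hc := hP.c_pos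
  have hαup : 0 < P.αup := hP.αlo_pos.trans_le hP.αlo_le
  refine ⟨P.ρ * (2 * Ls + P.c) + P.αup, by positivity, fun k hk => ?_⟩
  have hμ : P.μ D.ν k = D.ν := by simp [Params.μ, not_lt.mpr hk]
  obtain ⟨αB, hαB, m, z, h1, h2, -, h4⟩ := hx.2 k
  obtain ⟨ξ, hξ, hz⟩ := h1 m le_rfl
  rw [hμ] at hξ hz
  have hαB0 : 0 < αB := hP.αlo_pos.trans_le hαB.1
  refine ⟨ξ, hξ, αB * P.ρ ^ m, by positivity, ?_, by rwa [h4]⟩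
  have hpos : 0 < P.ρ * (2 * Ls + P.c) := by positivity
  cases m with
  | zero =>
    rw [pow_zero, mul_one]
    linarith [hαB.2]
  | succ m =>
    -- The last rejected constant must lie below the acceptance level; the accepted one is `ρ` times
    -- larger.
    have h5 : αB * P.ρ ^ m < 2 * Ls + P.c := by
      by_contra! h
      exact h2 m (Nat.lt_succ_self m)
        (hD.accept_of_isTrial hk (hx.mem_Ω k) (h1 m (Nat.le_succ m)) h)
    have h6 : αB * P.ρ ^ (m + 1) = P.ρ * (αB * P.ρ ^ m) := by ring
    have h7 := mul_le_mul_of_nonneg_left h5.le (by linarith : 0 ≤ P.ρ)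
    linarith

theorem exists_isCompact : ∃ S : Set (Vec n), IsCompact S ∧ ∀ k, x k ∈ S := by
  obtain ⟨b, hb⟩ : ∃ b, ∀ k, D.F D.ν (x k) ≤ b := by
    -- The descent test for `F(·;ν)` holds only from iteration `K` on, so the bound is the maximum
    -- over the iterates up to `K`.
    refine ⟨(Finset.range (P.K + 1)).sup' ⟨0, by simp⟩ fun j => D.F D.ν (x j), fun k => ?_⟩
    induction k using Nat.strong_induction_on with
    | _ k ih =>
      rcases Nat.lt_or_ge P.K k with h | h
      · obtain ⟨k, rfl⟩ : ∃ k', k = k' + 1 := ⟨k - 1, by omega⟩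
        have h1 := hx.F_succ_le (Nat.lt_succ_iff.mp h)
        have h2 : 0 ≤ P.c / 2 * ‖x (k + 1) - x k‖ ^ 2 := by
          have := hP.c_pos
          positivity
        refine (h1.trans (sub_le_self _ h2)).trans (Finset.sup'_le _ _ fun j hj => ?_)
        exact ih j (Nat.lt_succ_of_le (Finset.mem_Icc.mp hj).2)
      · exact Finset.le_sup' (fun j => D.F D.ν (x j)) (Finset.mem_range.mpr (by omega))
  exact ⟨_, (hD.level_bounded b).isCompact_closure, fun k => subset_closure
    ⟨hx.mem_Ω k, (hD.f_le_F _).trans (hb k)⟩⟩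

theorem tendsto_step : Tendsto (fun k => ‖x (k + 1) - x k‖) atTop (𝓝 0) := by
  obtain ⟨S, hS, hxS⟩ := hD.exists_isCompact hP hx
  have hF := hD.continuous_F D.ν
  refine tendsto_step_of_nonmonotone (φ := D.F D.ν) hP.c_pos (fun k hk => hx.F_succ_le hk) ?_ ?_
  · obtain ⟨b, hb⟩ := (hS.image hF).bddBelow
    exact ⟨b, fun k => hb ⟨x k, hxS k, rfl⟩⟩
  · intro ε hε
    obtain ⟨δ, hδ, h⟩ := Metric.uniformContinuousOn_iff.mp
      (hS.uniformContinuousOn_of_continuous hF.continuousOn) ε hε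
    refine ⟨δ, hδ, fun k hk => ?_⟩
    have h1 := h _ (hxS (k + 1)) _ (hxS k) (by rwa [dist_eq_norm])
    rw [Real.dist_eq] at h1
    linarith [le_abs_self (D.F D.ν (x (k + 1)) - D.F D.ν (x k))]

/-- Every coordinate is eventually zero, eventually at least `ν`, or eventually at most `-ν`. -/
theorem eventually_trichotomy (j : Fin n) :
    (∀ᶠ k in atTop, x k j = 0) ∨ (∀ᶠ k in atTop, D.ν ≤ x k j) ∨ ∀ᶠ k in atTop, x k j ≤ -D.ν := by
  have hν := hD.ν_pos
  obtain ⟨A, hA, hstep⟩ := hD.exists_bounded_alpha hP hx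
  obtain ⟨δ, hδ, hzero⟩ := hD.exists_forall_next_eq_zero hA
  have ht := hD.tendsto_step hP hx
  obtain ⟨k₁, hk₁⟩ := eventually_atTop.mp (((ht.eventually (ge_mem_nhds hδ)).and
    (ht.eventually (gt_mem_nhds hν))).and (eventually_ge_atTop P.K))
  have hnext : ∀ k ≥ k₁, |x k j| < D.ν → x (k + 1) j = 0 := by
    intro k hk hkj
    obtain ⟨⟨h1, -⟩, h3⟩ := hk₁ k hk
    obtain ⟨ξ, hξ, α, hα0, hαA, hmin⟩ := hstep k h3
    exact hzero _ (hx.mem_Ω k) _ ξ hξ α hα0 hαA hmin h1 j hkj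
  by_cases h : ∃ k ≥ k₁, |x k j| < D.ν
  · obtain ⟨k, hk, hkj⟩ := h
    refine Or.inl (eventually_atTop.mpr ⟨k + 1, fun i hi => ?_⟩)
    induction i, hi using Nat.le_induction with
    | base => exact hnext k hk hkj
    | succ i hi ih => exact hnext i (by omega) (by rw [ih, abs_zero]; exact hν)
  · push Not at h
    -- Changing sign while staying outside `(-ν, ν)` would need a jump of at least `2ν`.
    have hclose : ∀ k ≥ k₁, |x (k + 1) j - x k j| < D.ν := fun k hk =>
      (PiLp.norm_apply_le (x (k + 1) - x k) j).trans_lt (hk₁ k hk).1.2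
    refine Or.inr ?_
    rcases le_abs.mp (h k₁ le_rfl) with h1 | h1
    · refine Or.inl (eventually_atTop.mpr ⟨k₁, fun i hi => ?_⟩)
      induction i, hi using Nat.le_induction with
      | base => exact h1
      | succ i hi ih =>
        have h2 := abs_lt.mp (hclose i hi)
        rcases le_abs.mp (h (i + 1) (by omega)) with h3 | h3
        · exact h3
        · linarith
    · refine Or.inr (eventually_atTop.mpr ⟨k₁, fun i hi => ?_⟩)
      induction i, hi using Nat.le_induction with
      | base => linarith
      | succ i hi ih =>
        have h2 := abs_lt.mp (hclose i hi)
        rcases le_abs.mp (h (i + 1) (by omega)) with h3 | h3 <;> linarith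

/-! ### Accumulation points. -/

variable {a : Vec n} (ha : MapClusterPt a atTop x)
include ha

theorem clusterPt_trichotomy (j : Fin n) :
    (a j = 0 ∧ ∀ᶠ k in atTop, x k j = 0) ∨ (D.ν ≤ a j ∧ ∀ᶠ k in atTop, D.ν ≤ x k j) ∨
      (a j ≤ -D.ν ∧ ∀ᶠ k in atTop, x k j ≤ -D.ν) := by
  have hclosed : ∀ T : Set ℝ, IsClosed T → (∀ᶠ k in atTop, x k j ∈ T) → a j ∈ T := by
    intro T hT h
    have hc : Continuous fun y : Vec n => y j := by fun_prop
    have h1 : MapClusterPt (a j) atTop fun k => x k j := ha.continuousAt_comp hc.continuousAt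
    exact hT.mem_of_mapClusterPt h1 h
  rcases hD.eventually_trichotomy hP hx j with h | h | h
  · exact Or.inl ⟨hclosed {0} isClosed_singleton h, h⟩
  · exact Or.inr (Or.inl ⟨hclosed (Set.Ici D.ν) isClosed_Ici h, h⟩)
  · exact Or.inr (Or.inr ⟨hclosed (Set.Iic (-D.ν)) isClosed_Iic h, h⟩)

theorem eq_zero_iff_eventually (j : Fin n) : a j = 0 ↔ ∀ᶠ k in atTop, x k j = 0 := by
  have hν := hD.ν_pos
  rcases hD.clusterPt_trichotomy hP hx ha j with ⟨h1, h2⟩ | ⟨h1, h2⟩ | ⟨h1, h2⟩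
  · exact ⟨fun _ => h2, fun _ => h1⟩
  · refine ⟨fun h => by linarith, fun h => ?_⟩
    obtain ⟨k, h3, h4⟩ := (h2.and h).exists
    linarith
  · refine ⟨fun h => by linarith, fun h => ?_⟩
    obtain ⟨k, h3, h4⟩ := (h2.and h).exists
    linarith

theorem le_abs_of_ne_zero (j : Fin n) (hj : a j ≠ 0) : D.ν ≤ |a j| := by
  rcases hD.clusterPt_trichotomy hP hx ha j with ⟨h1, -⟩ | ⟨h1, -⟩ | ⟨h1, -⟩
  · exact absurd h1 hj
  · exact le_abs.mpr (Or.inl h1)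
  · exact le_abs.mpr (Or.inr (by linarith))

theorem eventually_idxI_eq : ∀ᶠ k in atTop, D.idxI (x k) = D.idxI a := by
  have hν := hD.ν_pos
  have h : ∀ j, ∀ᶠ k in atTop, D.idxI (x k) j = D.idxI a j := by
    intro j
    rcases hD.clusterPt_trichotomy hP hx ha j with ⟨h1, h2⟩ | ⟨h1, h2⟩ | ⟨h1, h2⟩ <;>
      filter_upwards [h2] with k hk
    · rw [hD.idxI_eq_zero h1, hD.idxI_eq_zero hk]
    · rw [idxI_of_le hν h1, idxI_of_le hν hk]
    · rw [idxI_of_le_neg hν h1, idxI_of_le_neg hν hk]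
  filter_upwards [eventually_all.mpr h] with k hk using funext hk

theorem eventually_idxJ_eq : ∀ᶠ k in atTop, D.idxJ (x k) = D.idxJ a := by
  have hν := hD.ν_pos
  have hp := hD.p_eq
  have h : ∀ l, ∀ᶠ k in atTop, D.idxJ (x k) l = D.idxJ a l := by
    intro l
    by_cases hl : ∀ j ∈ D.G l, a j = 0
    · have h1 : ∀ᶠ k in atTop, ∀ j ∈ D.G l, x k j = 0 := (Finset.eventually_all _).mpr fun j hj =>
        (hD.eq_zero_iff_eventually hP hx ha j).mp (hl j hj)
      filter_upwards [h1] with k hk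
      rw [idxJ_of_lt hν (by rwa [groupNorm_eq_zero hp hk]),
        idxJ_of_lt hν (by rwa [groupNorm_eq_zero hp hl])]
    · push Not at hl
      obtain ⟨j, hj, hj0⟩ := hl
      have h1 : ∀ᶠ k in atTop, D.ν ≤ |x k j| := by
        rcases hD.clusterPt_trichotomy hP hx ha j with ⟨h1, -⟩ | ⟨-, h2⟩ | ⟨-, h2⟩
        · exact absurd h1 hj0
        · filter_upwards [h2] with k hk using le_abs.mpr (Or.inl hk)
        · filter_upwards [h2] with k hk using le_abs.mpr (Or.inr (by linarith))
      filter_upwards [h1] with k hk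
      rw [idxJ_of_le hν (hk.trans (abs_le_groupNorm hp _ hj)), idxJ_of_le hν
        ((hD.le_abs_of_ne_zero hP hx ha j hj0).trans (abs_le_groupNorm hp _ hj))]
  filter_upwards [eventually_all.mpr h] with k hk using funext hk

theorem clusterPt_isArgmin_f : IsArgmin D.f (D.Ω ∩ supportedOn a) a := by
  have haΩ : a ∈ D.Ω := isClosed_Ω.mem_of_mapClusterPt ha (Eventually.of_forall hx.mem_Ω)
  obtain ⟨A, -, hstep⟩ := hD.exists_bounded_alpha hP hx
  choose! ξ hξ α hα0 hαA hmin using hstep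
  -- This filter plays the role of a subsequence converging to `a`.
  have hne : (atTop ⊓ comap x (𝓝 a)).NeBot := by
    rw [inf_comm]
    exact neBot_inf_comap_iff_map'.mpr ha
  have hle : atTop ⊓ comap x (𝓝 a) ≤ atTop := inf_le_left
  have hu : Tendsto x (atTop ⊓ comap x (𝓝 a)) (𝓝 a) := tendsto_comap.mono_left inf_le_right
  have hd : Tendsto (fun k => x (k + 1) - x k) (atTop ⊓ comap x (𝓝 a)) (𝓝 0) :=
    (tendsto_zero_iff_norm_tendsto_zero.mpr (hD.tendsto_step hP hx)).mono_left hle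
  have hv : Tendsto (fun k => x (k + 1)) (atTop ⊓ comap x (𝓝 a)) (𝓝 a) := by
    simpa using hu.add hd
  have hK := hle (eventually_ge_atTop P.K)
  have hI := hle (hD.eventually_idxI_eq hP hx ha)
  have hJ := hle (hD.eventually_idxJ_eq hP hx ha)
  refine hD.isArgmin_f_of_tendsto (hD.le_abs_of_ne_zero hP hx ha) haΩ hu hv (α := α) (A := A)
    (ξ := ξ) ?_ ?_ ?_ ?_
  · filter_upwards [hK] with k hk using hαA k hk
  · filter_upwards [hK] with k hk using hα0 k hk
  · filter_upwards [hK, hI, hJ] with k hk h1 h2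
    rw [← h1, ← h2]
    exact hξ k hk
  · filter_upwards [hK, hI, hJ] with k hk h1 h2
    rw [← h1, ← h2]
    exact hmin k hk

end Assumptions

end Data

theorem finite_setOf_succ_ne {β : Type*} {s : ℕ → β} {b : β} (h : ∀ᶠ k in atTop, s k = b) :
    {k | s (k + 1) ≠ s k}.Finite := by
  obtain ⟨k₀, hk₀⟩ := eventually_atTop.mp h
  refine (Set.finite_lt_nat k₀).subset fun k hk => ?_
  by_contra h1
  have h2 : k₀ ≤ k := not_lt.mp h1
  exact hk ((hk₀ (k + 1) (by omega)).trans (hk₀ k h2).symm)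

end SparseGroup

theorem theorem3p1 {n L : ℕ} (D : SparseGroup.Data n L) (Lf Ls : ℝ) (hD : D.Assumptions Lf Ls)
    (P : SparseGroup.Params) (hP : P.Valid D.ν Ls)
    (x : ℕ → SparseGroup.Vec n) (hx : D.IsIterates P x) :
    ({k | D.idxI (x (k + 1)) ≠ D.idxI (x k)}.Finite ∧
      {k | D.idxJ (x (k + 1)) ≠ D.idxJ (x k)}.Finite) ∧
    (∀ a b : SparseGroup.Vec n, MapClusterPt a Filter.atTop x → MapClusterPt b Filter.atTop x →
      SparseGroup.zeroSet a = SparseGroup.zeroSet b) ∧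
    (∀ a : SparseGroup.Vec n, MapClusterPt a Filter.atTop x →
      ∃ k₀ : ℕ, ∀ k ≥ k₀, ∀ j ∈ SparseGroup.zeroSet a, x k j = 0) ∧
    (∀ a : SparseGroup.Vec n, MapClusterPt a Filter.atTop x →
      D.IsSwdStationary a ∧ D.IsStrongLocalMin a) := by
  refine ⟨?_, fun a b ha hb => ?_, fun a ha => ?_, fun a ha => ?_⟩
  -- Index stabilization is proved relative to an accumulation point, so one has to exist.
  · obtain ⟨S, hS, hxS⟩ := hD.exists_isCompact hP hx
    obtain ⟨a, -, ha⟩ := hS.exists_mapClusterPt (u := x) (f := Filter.atTop)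
      (Filter.tendsto_principal.mpr (Filter.Eventually.of_forall hxS))
    exact ⟨SparseGroup.finite_setOf_succ_ne (hD.eventually_idxI_eq hP hx ha),
      SparseGroup.finite_setOf_succ_ne (hD.eventually_idxJ_eq hP hx ha)⟩
  · ext j
    exact (hD.eq_zero_iff_eventually hP hx ha j).trans (hD.eq_zero_iff_eventually hP hx hb j).symm
  · refine Filter.eventually_atTop.mp (Filter.eventually_all.mpr fun j => ?_)
    by_cases hj : a j = 0
    · filter_upwards [(hD.eq_zero_iff_eventually hP hx ha j).mp hj] with k hk _ using hk
    · exact Filter.Eventually.of_forall fun k hk => absurd hk hj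
  · have hbig := hD.le_abs_of_ne_zero hP hx ha
    have hmin := hD.clusterPt_isArgmin_f hP hx ha
    exact ⟨hD.isSwdStationary_of_isArgmin_f hbig hmin, hD.isStrongLocalMin_of_isArgmin_f hbig hmin⟩
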